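/- Let $G$ be a discrete subgroup of $\mathrm{PSL}_2(\mathbb{R})$ acting on the hyperbolic upper half-plane $(\mathbb{H},d)$, freely generated by hyperbolic elements $h_1,\dots,h_u$ and parabolic elements $\gamma_1,\dots,\gamma_v$ with $v\ge 1$ and $u+v>1$ (being free, $G$ may be identified with an isomorphic lift to $\mathrm{SL}_2(\mathbb{R})$). Put $H_0=\{h_i^{\pm1}\}$, $\Gamma_0=\{\gamma_j^{\pm1}\}$ and $G_0=H_0\cup\Gamma_0$. Let $F=\{z\in\mathbb{H} : d(z,i)\le d(z,g(i))\text{ for all }g\in G\}$ be the closed Dirichlet fundamental domain of $G$ centred at $i$, and assume that its sides are labelled by $G_0$: the elements $g\ne 1$ of $G$ for which $F$ and $gF$ have a side in common (that is, meet in more than one point) are exactly the elements of $G_0$. For $x\in\partial\mathbb{H}=\mathbb{R}\cup\{\infty\}$ let $s_x$ be the geodesic ray from $i$ to $x$. The radial limit set $L_r(G)$ is the set of those $x$ for which there is a constant $c$ such that $s_x$ contains, at arbitrarily large times, points at distance at most $c$ from the orbit $G(i)$. For $x\in L_r(G)$ the infinite word $\omega_1\omega_2\cdots$ over $G_0$ associated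 with $x$ is obtained by recording the labels of the sides through which $s_x$ exits the tiles it traverses: $s_x$ traverses successively the tiles $F,\ \omega_1F,\ \omega_1\omega_2F,\dots$. This word is divided into consecutive blocks $B_1(x),B_2(x),\dots$: each letter from $H_0$ is a block of length $1$, and each maximal run of $n$ consecutive occurrences of the same letter from $\Gamma_0$ is a block of length $n$. The cusp-winding sequence of $x$ is $a_k(x)=|B_k(x)|-1$, $k\ge1$, where $|B_k(x)|$ is the length of the $k$-th block. With $\log^+(a)=\log a$ for $a>0$ and $\log^+(0)=0$, let $$\mathcal{F}_1=\Big\{x\in L_r(G) : \lim_{n\to\infty}\frac{2\sum_{k=1}^n\log^+(a_k(x))}{d\big(B_1(x)\cdots B_n(x)(i),\,i\big)}=1\Big\}.$$ Then for every $x\in\mathcal{F}_1$ the sequence $(a_n(x))_{n\ge1}$ is unbounded. -/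

import Mathlib

open UpperHalfPlane Filter Topology
open scoped MatrixGroups Pointwise

namespace CuspWinding

noncomputable section

/-- The parameter at time `t` of the unit speed geodesic ray `s_x` in the upper half-plane that
starts at `i` and ends at the boundary point `x ∈ ∂ℍ = ℝ ∪ {∞}`. For `x = ∞` it is `t ↦ e^t i`;
for real `x` it is the image of that ray under the rotation `z ↦ (x z - 1) / (z + x)`, which fixes
`i` and sends `∞` to `x`. -/
def ray : OnePoint ℝ → ℝ → ℍ
  | OnePoint.infty, t => ⟨⟨0, Real.exp t⟩, Real.exp_pos t⟩
  | OnePoint.some x, t =>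
      ⟨⟨x * (Real.exp t ^ 2 - 1) / (x ^ 2 + Real.exp t ^ 2),
        Real.exp t * (1 + x ^ 2) / (x ^ 2 + Real.exp t ^ 2)⟩, by
          show 0 < Real.exp t * (1 + x ^ 2) / (x ^ 2 + Real.exp t ^ 2)
          positivity⟩

/-- The radial (conical) limit set of `G`: the boundary points `x` such that the ray from `i` to `x`
returns at arbitrarily large times to a bounded neighbourhood of the orbit of `i`. -/
def radialLimitSet (G : Subgroup SL(2, ℝ)) : Set (OnePoint ℝ) :=
  {x | ∃ c : ℝ, ∃ᶠ t in atTop, ∃ g ∈ G, dist (ray x t) (g • I) ≤ c}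

/-- The (closed) Dirichlet fundamental domain of `G` centred at `i`. -/
def dirichletDomain (G : Subgroup SL(2, ℝ)) : Set ℍ :=
  {z | ∀ g ∈ G, dist z I ≤ dist z (g • I)}

/-- The labels of the sides of the Dirichlet domain `F`: the nontrivial `g ∈ G` for which `F` and
the tile `g F` share a side, i.e. meet in more than one point (by convexity, in a nondegenerate
geodesic arc). -/
def sideLabels (G : Subgroup SL(2, ℝ)) : Set SL(2, ℝ) :=
  {g | g ∈ G ∧ g ≠ 1 ∧ (dirichletDomain G ∩ g • dirichletDomain G).Nontrivial}

/-- The symmetric set `{f_i, f_i⁻¹}` of a family of group elements. -/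
def symmSet {ι : Type} (f : ι → SL(2, ℝ)) : Set SL(2, ℝ) :=
  Set.range f ∪ Set.range fun i => (f i)⁻¹

/-- `G` is a Fuchsian group, freely generated by the hyperbolic elements `h_1, …, h_u` and the
parabolic elements `γ_1, …, γ_v`, so that `G` is the free product of the cyclic groups `⟨h_i⟩` and
`⟨γ_j⟩`, and the sides of its Dirichlet domain centred at `i` are labelled by the symmetric set
`G₀` of these generators.

A free group of Möbius transformations lifts isomorphically from `PSL(2, ℝ)` to `SL(2, ℝ)`, and a
free subgroup of `SL(2, ℝ)` does not contain `-1`; so matrices are used to represent the elements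
of the group. -/
structure IsFreeFuchsian {u v : ℕ} (G : Subgroup SL(2, ℝ))
    (h : Fin u → SL(2, ℝ)) (γ : Fin v → SL(2, ℝ)) : Prop where
  discrete : DiscreteTopology G
  free : Function.Injective (FreeGroup.lift (Sum.elim h γ))
  generates : (FreeGroup.lift (Sum.elim h γ)).range = G
  hyperbolic : ∀ i, (h i : Matrix (Fin 2) (Fin 2) ℝ).IsHyperbolic
  parabolic : ∀ j, (γ j : Matrix (Fin 2) (Fin 2) ℝ).IsParabolic
  sides : sideLabels G = symmSet h ∪ symmSet γ

/-- The time at which the ray `s_x` exits the tile `g F`. -/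
def exitTime (G : Subgroup SL(2, ℝ)) (x : OnePoint ℝ) (g : SL(2, ℝ)) : ℝ :=
  sSup {t | 0 ≤ t ∧ ray x t ∈ g • dirichletDomain G}

open Classical in
/-- The label of the side at which the ray `s_x` exits the tile `g F`: the `ω ∈ G₀` such that the
exit point lies in the side `g F ∩ g ω F` (and `1` if there is no such side). -/
def exitLabel (G : Subgroup SL(2, ℝ)) (x : OnePoint ℝ) (g : SL(2, ℝ)) : SL(2, ℝ) :=
  if hω : ∃ ω ∈ sideLabels G,
      ray x (exitTime G x g) ∈ g • (dirichletDomain G ∩ ω • dirichletDomain G)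
  then hω.choose else 1

/-- The element `ω_1 ⋯ ω_n` of `G`; the ray `s_x`, starting in the tile `F`, traverses successively
the tiles `F, ω_1 F, ω_1 ω_2 F, …`. -/
def tile (G : Subgroup SL(2, ℝ)) (x : OnePoint ℝ) : ℕ → SL(2, ℝ)
  | 0 => 1
  | n + 1 => tile G x n * exitLabel G x (tile G x n)

/-- The infinite word of `x`; `letter G x n` is its letter `ω_{n+1}`, the label of the side at which
`s_x` exits the `n`-th tile (counted from zero). -/
def letter (G : Subgroup SL(2, ℝ)) (x : OnePoint ℝ) (n : ℕ) : SL(2, ℝ) :=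
  exitLabel G x (tile G x n)

/-- Decomposition of a word `ω` into blocks, with respect to a set `P` of parabolic generators:
`blockStart P ω k` is the position at which the `k`-th block (counted from zero) begins. A letter
not in `P` is a block on its own; a letter in `P` forms a block with all its immediately following
repetitions. -/
def blockStart (P : Set SL(2, ℝ)) (ω : ℕ → SL(2, ℝ)) : ℕ → ℕ
  | 0 => 0
  | k + 1 => sInf {m | blockStart P ω k < m ∧
      ¬ (ω (blockStart P ω k) ∈ P ∧ ω m = ω (blockStart P ω k))}

variable {v : ℕ} (G : Subgroup SL(2, ℝ)) (γ : Fin v → SL(2, ℝ)) (x : OnePoint ℝ)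

/-- The cusp-winding process: the length minus one of the `k`-th block (counted from zero, so that
this is `a_{k+1}(x)` when blocks are counted from one) of the infinite word of `x`. -/
def cuspWinding (k : ℕ) : ℕ :=
  blockStart (symmSet γ) (letter G x) (k + 1) - blockStart (symmSet γ) (letter G x) k - 1

/-- The product `B_1 ⋯ B_n ∈ G` of the first `n` blocks of the infinite word of `x`. -/
def blockProd (n : ℕ) : SL(2, ℝ) :=
  tile G x (blockStart (symmSet γ) (letter G x) n)

/-- The level set `𝓕_α` of the points of the radial limit set with mean cusp-winding number `α`. -/
def levelSet (α : ℝ) : Set (OnePoint ℝ) :=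
  {x | x ∈ radialLimitSet G ∧
    Tendsto (fun n : ℕ => 2 * (∑ k ∈ Finset.range n, Real.posLog (cuspWinding G γ x k)) /
      dist (blockProd G γ x n • I) I) atTop (𝓝 α)}

end

end CuspWinding

/-! Suppose the winding numbers of x are bounded by N. The claim is that each passage along a cusp
costs a definite amount of time more than 2 log a, which keeps the limit from being 1.

Freeness makes the adjacency graph of the tiles a forest, so the tessellation has no vertices and
every side is a complete geodesic (`HasTreeSides.exists_pair`, `HasTreeSides.mem_cell_of_bisector`).
Normalise a cusp so that its parabolic letter is a horizontal translation by ±1. Then F lies in a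
strip of width one, and every side not at this cusp is a semicircle of radius at most 1/2
(`HasTreeSides.im_smul_le_half`). At each point the heights over two different cusps of F have
product at most 1/2 (`HasTreeSides.im_smul_mul_im_smul_le`). Hence in the first tile of each block
after the initial one there is a point of the ray at height at most 1/√2 over the cusp of the
preceding letter and that of the next letter, whenever these are parabolic
(`HasTreeSides.exists_low_time`).

Between two such points a block with winding number a ≥ 1 covers horizontal distance at least a, so
it takes time at least 2 log a + log 2 (`run_time_le`). As a ≤ N, the term log 2 is at least a fixed
fraction ε of 2 log a, whence (1 + ε) · 2 ∑ log⁺ a_k ≤ time + constant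
(`IsFreeFuchsian.exists_sum_posLog_le`). At the return times of the radial limit point, d(B_1 ⋯ B_n
i, i) is at least the time minus a constant (`IsFreeFuchsian.exists_le_dist_blockProd`). So
infinitely often the ratio is at most about 1 / (1 + ε). -/

namespace CuspWinding

/-! ### The projective chart and local finiteness of the tessellation. -/

/-- The affine function `(x, s) ↦ (s - 2 x Re w + |w|²) / Im w`; at `(Re z, |z|²)` it takes the value
`2 Im z cosh d(z, w)`. -/
noncomputable def aff (w : ℍ) (q : ℝ × ℝ) : ℝ :=
  (q.2 - 2 * q.1 * w.re + (w.re ^ 2 + w.im ^ 2)) / w.im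

/-- The linear part of `aff w`. -/
noncomputable def lin (w : ℍ) (v : ℝ × ℝ) : ℝ := (v.2 - 2 * v.1 * w.re) / w.im

/-- The projective chart `z ↦ (Re z, |z|²)` of the hyperbolic plane, in which geodesics are
straight. -/
def proj (z : ℍ) : ℝ × ℝ := (z.re, z.re ^ 2 + z.im ^ 2)

/-- The image of `proj`: the inside of a parabola. -/
def para : Set (ℝ × ℝ) := {q | q.1 ^ 2 < q.2}

theorem proj_mem_para (z : ℍ) : proj z ∈ para := by
  have := z.im_pos
  simp only [para, proj, Set.mem_ofPred_eq]; nlinarith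

theorem exists_proj_eq {q : ℝ × ℝ} (hq : q ∈ para) : ∃ z : ℍ, proj z = q := by
  have h : 0 < q.2 - q.1 ^ 2 := sub_pos.2 hq
  refine ⟨⟨⟨q.1, √(q.2 - q.1 ^ 2)⟩, Real.sqrt_pos.2 h⟩, ?_⟩
  ext
  · rfl
  · change q.1 ^ 2 + √(q.2 - q.1 ^ 2) ^ 2 = q.2
    rw [Real.sq_sqrt h.le]; ring

theorem continuous_proj : Continuous proj := by
  unfold proj; fun_prop

theorem isOpen_para : IsOpen para := isOpen_lt (by fun_prop) (by fun_prop)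

theorem convex_para : Convex ℝ para := by
  intro p hp q hq a b ha hb hab
  simp only [para, Set.mem_ofPred_eq, Prod.fst_add, Prod.smul_fst, Prod.snd_add, Prod.smul_snd,
    smul_eq_mul] at *
  obtain rfl : b = 1 - a := by linarith
  rcases ha.eq_or_lt with rfl | ha
  · simpa using hq
  · nlinarith [mul_nonneg (mul_nonneg ha.le hb) (sq_nonneg (p.1 - q.1)), mul_pos ha (sub_pos.2 hp),
      mul_nonneg hb (sub_pos.2 hq).le]

@[fun_prop]
theorem continuous_aff (w : ℍ) : Continuous (aff w) := by unfold aff; fun_prop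

@[fun_prop]
theorem continuous_lin (w : ℍ) : Continuous (lin w) := by unfold lin; fun_prop

theorem aff_add_smul (w : ℍ) (p v : ℝ × ℝ) (t : ℝ) :
    aff w (p + t • v) = aff w p + t * lin w v := by
  simp only [aff, lin, Prod.fst_add, Prod.smul_fst, Prod.snd_add, Prod.smul_snd, smul_eq_mul]
  ring

theorem lin_sub (w : ℍ) (p q : ℝ × ℝ) : lin w (q - p) = aff w q - aff w p := by
  simp only [aff, lin, Prod.fst_sub, Prod.snd_sub]
  ring

theorem lin_comb (w : ℍ) (v v' : ℝ × ℝ) (a b : ℝ) :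
    lin w (a • v + b • v') = a * lin w v + b * lin w v' := by
  simp only [lin, Prod.fst_add, Prod.smul_fst, Prod.snd_add, Prod.smul_snd, smul_eq_mul]
  ring

theorem cosh_dist_eq (z w : ℍ) :
    Real.cosh (dist z w) = ((z.re - w.re) ^ 2 + z.im ^ 2 + w.im ^ 2) / (2 * z.im * w.im) := by
  have h1 := z.im_ne_zero
  have h2 := w.im_ne_zero
  rw [UpperHalfPlane.cosh_dist, Complex.dist_eq, ← Complex.normSq_eq_norm_sq, Complex.normSq_apply]
  simp only [Complex.sub_re, Complex.sub_im, coe_re, coe_im]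
  field_simp
  ring

theorem aff_proj (z w : ℍ) : aff w (proj z) = 2 * z.im * Real.cosh (dist z w) := by
  have h1 := z.im_ne_zero
  have h2 := w.im_ne_zero
  rw [cosh_dist_eq]
  simp only [aff, proj]
  field_simp
  ring

theorem dist_le_dist_iff (z w w' : ℍ) :
    dist z w ≤ dist z w' ↔ aff w (proj z) ≤ aff w' (proj z) := by
  rw [aff_proj, aff_proj, mul_le_mul_iff_right₀ (by have := z.im_pos; positivity),
    Real.cosh_le_cosh, abs_of_nonneg dist_nonneg, abs_of_nonneg dist_nonneg]

theorem dist_eq_dist_iff (z w w' : ℍ) :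
    dist z w = dist z w' ↔ aff w (proj z) = aff w' (proj z) := by
  simp only [le_antisymm_iff, dist_le_dist_iff]

theorem aff_pos (w : ℍ) {q : ℝ × ℝ} (hq : q ∈ para) : 0 < aff w q := by
  obtain ⟨z, rfl⟩ := exists_proj_eq hq
  rw [aff_proj]
  have := z.im_pos
  have := Real.cosh_pos (dist z w)
  positivity

variable {G : Subgroup SL(2, ℝ)}

/-- The tile `k F` in the projective chart. -/
def cell (G : Subgroup SL(2, ℝ)) (k : SL(2, ℝ)) : Set (ℝ × ℝ) :=
  {q | q ∈ para ∧ ∀ g ∈ G, aff (k • I) q ≤ aff (g • I) q}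

theorem mem_smul_dirichletDomain_iff {k : SL(2, ℝ)} (hk : k ∈ G) (z : ℍ) :
    z ∈ k • dirichletDomain G ↔ ∀ g ∈ G, dist z (k • I) ≤ dist z (g • I) := by
  rw [Set.mem_smul_set_iff_inv_smul_mem, dirichletDomain, Set.mem_ofPred_eq]
  have e (w : ℍ) : dist (k⁻¹ • z) w = dist z (k • w) := by
    rw [← dist_smul k (k⁻¹ • z) w, smul_inv_smul]
  simp only [e]
  constructor
  · intro h g hg
    simpa [← mul_smul] using h (k⁻¹ * g) (mul_mem (inv_mem hk) hg)
  · intro h g hg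
    simpa [← mul_smul] using h (k * g) (mul_mem hk hg)

theorem proj_mem_cell_iff {k : SL(2, ℝ)} (hk : k ∈ G) (z : ℍ) :
    proj z ∈ cell G k ↔ z ∈ k • dirichletDomain G := by
  rw [mem_smul_dirichletDomain_iff hk, cell, Set.mem_ofPred_eq]
  simp only [dist_le_dist_iff, proj_mem_para, true_and]

theorem finite_orbit_ball [DiscreteTopology G] (R : ℝ) :
    {k : SL(2, ℝ) | k ∈ G ∧ dist I (k • I) ≤ R}.Finite := by
  have h := (ProperlyDiscontinuousSMul.finite_disjoint_inter_image (Γ := G) (T := ℍ)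
    (isCompact_singleton (x := I)) (isCompact_closedBall I R))
  refine (h.image Subtype.val).subset ?_
  rintro k ⟨hk, hd⟩
  refine ⟨⟨k, hk⟩, ?_, rfl⟩
  simp only [Set.mem_ofPred_eq, Set.image_singleton]
  exact ⟨k • I, by simp [Subgroup.smul_def], by simpa [dist_comm] using hd⟩

/-- For q near p the point q + l (q - `proj I`), beyond q as seen from `proj I`, still lies in
`para`, where `aff (k • I)` is positive. Affinity then bounds its value 2 cosh d(i, k i) at `proj I`
by (1 + l) / l · B. -/
theorem eventually_finite_of_aff_le [DiscreteTopology G] {p : ℝ × ℝ} (hp : p ∈ para) (B : ℝ) :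
    ∃ S : Set SL(2, ℝ), S.Finite ∧
      ∀ᶠ q in 𝓝 p, q ∈ para ∧ ∀ k ∈ G, aff (k • I) q ≤ B → k ∈ S := by
  obtain ⟨l, hl, hlp⟩ : ∃ l : ℝ, 0 < l ∧ p + l • (p - proj I) ∈ para := by
    have hc : Continuous fun l : ℝ => p + l • (p - proj I) := by fun_prop
    have : ∀ᶠ l in 𝓝 (0 : ℝ), p + l • (p - proj I) ∈ para :=
      hc.continuousAt (isOpen_para.mem_nhds (by simpa using hp))
    have h2 := (this.filter_mono nhdsWithin_le_nhds).and
      (eventually_mem_nhdsWithin : ∀ᶠ l in 𝓝[>] (0 : ℝ), l ∈ Set.Ioi 0)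
    obtain ⟨l, h, h'⟩ := h2.exists
    exact ⟨l, h', h⟩
  have hc : Continuous fun q : ℝ × ℝ => q + l • (q - proj I) := by fun_prop
  refine ⟨_, finite_orbit_ball (G := G) ((1 + l) / l * B), ?_⟩
  filter_upwards [isOpen_para.mem_nhds hp, hc.continuousAt (isOpen_para.mem_nhds hlp)]
    with q hq hq'
  refine ⟨hq, fun k hk hB => ⟨hk, ?_⟩⟩
  have h1 := aff_pos (k • I) hq'
  rw [aff_add_smul, lin_sub, aff_proj, I_im] at h1
  have h2 : l * (2 * Real.cosh (dist I (k • I))) ≤ (1 + l) * B := by nlinarith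
  have h3 : dist I (k • I) ≤ 2 * Real.cosh (dist I (k • I)) := by
    rw [Real.cosh_eq]
    linarith [Real.add_one_le_exp (dist I (k • I)), Real.exp_pos (-dist I (k • I))]
  rw [div_mul_eq_mul_div, le_div_iff₀ hl]
  nlinarith

theorem exists_mem_cell [DiscreteTopology G] {p : ℝ × ℝ} (hp : p ∈ para) :
    ∃ k ∈ G, p ∈ cell G k := by
  obtain ⟨S, hS, h⟩ := eventually_finite_of_aff_le (G := G) hp (aff I p)
  have hfin : {k : SL(2, ℝ) | k ∈ G ∧ aff (k • I) p ≤ aff I p}.Finite :=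
    hS.subset fun k hk => h.self_of_nhds.2 k hk.1 hk.2
  obtain ⟨k, hk, hmin⟩ := hfin.exists_minimalFor (fun k => aff (k • I) p) _
    ⟨1, G.one_mem, by simp⟩
  refine ⟨k, hk.1, hp, fun g hg => ?_⟩
  by_cases hgI : aff (g • I) p ≤ aff I p
  · exact (le_total (aff (k • I) p) (aff (g • I) p)).elim id fun h' => hmin ⟨hg, hgI⟩ h'
  · exact hk.2.trans (not_le.1 hgI).le

theorem finite_cells [DiscreteTopology G] {p : ℝ × ℝ} (hp : p ∈ para) :
    {k : SL(2, ℝ) | k ∈ G ∧ p ∈ cell G k}.Finite := by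
  obtain ⟨S, hS, h⟩ := eventually_finite_of_aff_le (G := G) hp (aff I p)
  refine hS.subset fun k hk => h.self_of_nhds.2 k hk.1 ?_
  simpa using hk.2.2 1 G.one_mem

/-- Tiles that meet a small neighbourhood of `p` contain `p`. -/
theorem eventually_mem_cell [DiscreteTopology G] {p : ℝ × ℝ} (hp : p ∈ para) :
    ∀ᶠ q in 𝓝 p, q ∈ para ∧ ∀ k ∈ G, q ∈ cell G k → p ∈ cell G k := by
  obtain ⟨S, hS, h⟩ := eventually_finite_of_aff_le (G := G) hp (aff I p + 1)
  have h1 : ∀ᶠ q in 𝓝 p, aff I q < aff I p + 1 :=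
    (continuous_aff I).continuousAt.eventually_lt continuousAt_const (by simp)
  have h2 : ∀ᶠ q in 𝓝 p, ∀ k ∈ S, p ∉ cell G k → q ∉ cell G k := by
    rw [eventually_all_finite hS]
    intro k _
    by_cases hk : p ∈ cell G k
    · simp [hk]
    · have : ∃ g ∈ G, aff (g • I) p < aff (k • I) p := by
        by_contra! hcon
        exact hk ⟨hp, hcon⟩
      obtain ⟨g, hg, hlt⟩ := this
      filter_upwards [(continuous_aff (g • I)).continuousAt.eventually_lt
        (continuous_aff (k • I)).continuousAt hlt] with q hq _ hqk
      exact absurd (hqk.2 g hg) (not_le.2 hq)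
  filter_upwards [h, h1, h2] with q hq hq1 hq2
  refine ⟨hq.1, fun k hk hqk => ?_⟩
  by_contra hcon
  refine hq2 k (hq.2 k hk ?_) hcon hqk
  exact (by simpa using hqk.2 1 G.one_mem : aff (k • I) q ≤ aff I q).trans hq1.le

/-- Near p only the tiles through p compete for the minimum, so membership is decided by them. -/
theorem eventually_mem_cell_of_le [DiscreteTopology G] {p : ℝ × ℝ} (hp : p ∈ para) :
    ∀ᶠ q in 𝓝 p, ∀ k, (∀ g ∈ G, p ∈ cell G g → aff (k • I) q ≤ aff (g • I) q) → q ∈ cell G k := by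
  filter_upwards [eventually_mem_cell (G := G) hp] with q hq k hk
  obtain ⟨g, hg, hqg⟩ := exists_mem_cell (G := G) hq.1
  exact ⟨hq.1, fun g' hg' => (hk g hg (hq.2 g hg hqg)).trans (hqg.2 g' hg')⟩

theorem aff_eq_of_mem_cell {p : ℝ × ℝ} {k k' : SL(2, ℝ)} (hk : k ∈ G) (hk' : k' ∈ G)
    (h : p ∈ cell G k) (h' : p ∈ cell G k') : aff (k • I) p = aff (k' • I) p :=
  le_antisymm (h.2 k' hk') (h'.2 k hk)


/-! ### Absence of vertices: sides are complete geodesics. -/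

/-- A discrete group acting freely on the orbit of `i` whose graph of tiles and sides is a forest, in
the form that every finite set of tiles contains a tile with at most one neighbour in the set. -/
structure HasTreeSides (G : Subgroup SL(2, ℝ)) : Prop where
  discrete : DiscreteTopology G
  stab : ∀ k ∈ G, k • I = I → k = 1
  leaf : ∀ K : Set SL(2, ℝ), K.Finite → K.Nonempty → K ⊆ G →
    ∃ k ∈ K, ∃ k₁, ∀ k' ∈ K, k⁻¹ * k' ∈ sideLabels G → k' = k₁

theorem HasTreeSides.eq_of_smul_eq (hG : HasTreeSides G) {k k' : SL(2, ℝ)} (hk : k ∈ G)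
    (hk' : k' ∈ G) (h : k • I = k' • I) : k = k' := by
  have := hG.stab (k'⁻¹ * k) (mul_mem (inv_mem hk') hk) (by rw [mul_smul, h, inv_smul_smul])
  exact (inv_mul_eq_one.1 this).symm

theorem nontrivial_inter_smul {k k' : SL(2, ℝ)} {s : Set ℍ} {z z' : ℍ} (hz : z ∈ k • s)
    (hz' : z' ∈ k • s) (hzk : z ∈ k' • s) (hzk' : z' ∈ k' • s) (hne : z ≠ z') :
    (s ∩ (k⁻¹ * k') • s).Nontrivial := by
  simp only [Set.mem_smul_set_iff_inv_smul_mem] at hz hz' hzk hzk'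
  refine ⟨k⁻¹ • z, ⟨hz, ?_⟩, k⁻¹ • z', ⟨hz', ?_⟩, fun h => hne (smul_left_cancel _ h)⟩ <;>
  · rw [Set.mem_smul_set_iff_inv_smul_mem, mul_inv_rev, inv_inv, mul_smul, smul_inv_smul]
    assumption

theorem inv_mem_sideLabels {g : SL(2, ℝ)} (hg : g ∈ sideLabels G) : g⁻¹ ∈ sideLabels G := by
  obtain ⟨h1, h2, z, hz, z', hz', hne⟩ := hg
  refine ⟨inv_mem h1, inv_ne_one.2 h2, ?_⟩
  simpa using nontrivial_inter_smul (k' := 1) hz.2 hz'.2 (by simpa using hz.1)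
    (by simpa using hz'.1) hne

/-- If both cells contain a germ of a ray from `p` in direction `v`, they share a side. -/
theorem mem_sideLabels_of_direction [DiscreteTopology G] {p v : ℝ × ℝ} {k k' : SL(2, ℝ)}
    (hk : k ∈ G) (hk' : k' ∈ G) (hne : k ≠ k') (hpk : p ∈ cell G k) (hpk' : p ∈ cell G k')
    (hv : v ≠ 0) (h : ∀ g ∈ G, p ∈ cell G g → lin (k • I) v ≤ lin (g • I) v)
    (h' : ∀ g ∈ G, p ∈ cell G g → lin (k' • I) v ≤ lin (g • I) v) :
    k⁻¹ * k' ∈ sideLabels G := by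
  have hc : Tendsto (fun t : ℝ => p + t • v) (𝓝[>] 0) (𝓝 p) := by
    have : Continuous fun t : ℝ => p + t • v := by fun_prop
    simpa using (this.tendsto 0).mono_left nhdsWithin_le_nhds
  obtain ⟨t, ht, ht0⟩ := ((hc.eventually (eventually_mem_cell_of_le (G := G) hpk.1)).and
    eventually_mem_nhdsWithin).exists
  replace ht0 : 0 < t := ht0
  have key (l : SL(2, ℝ)) (hl : l ∈ G) (hpl : p ∈ cell G l)
      (h : ∀ g ∈ G, p ∈ cell G g → lin (l • I) v ≤ lin (g • I) v) : p + t • v ∈ cell G l := by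
    refine ht l fun g hg hpg => ?_
    rw [aff_add_smul, aff_add_smul, aff_eq_of_mem_cell hl hg hpl hpg]
    gcongr
    exact h g hg hpg
  have h1 := key k hk hpk h
  have h2 := key k' hk' hpk' h'
  obtain ⟨z, rfl⟩ := exists_proj_eq hpk.1
  obtain ⟨z', hz'⟩ := exists_proj_eq h1.1
  rw [← hz'] at h1 h2
  rw [proj_mem_cell_iff hk] at hpk h1
  rw [proj_mem_cell_iff hk'] at hpk' h2
  refine ⟨mul_mem (inv_mem hk) hk', by simpa [inv_mul_eq_one] using hne,
    nontrivial_inter_smul hpk h1 hpk' h2 ?_⟩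
  rintro rfl
  have : t • v = 0 := by simpa using hz'
  exact (smul_ne_zero ht0.ne' hv) this

theorem lin_ne_of_ne {w₀ w₁ : ℍ} (hne : w₀ ≠ w₁) :
    w₁.re / w₁.im - w₀.re / w₀.im ≠ 0 ∨ 1 / w₁.im - 1 / w₀.im ≠ 0 := by
  by_contra! h
  obtain ⟨h1, h2⟩ := h
  have h3 : w₀.im = w₁.im := by
    have := sub_eq_zero.1 h2
    simpa using this.symm
  apply hne
  rw [h3, sub_eq_zero, div_left_inj' w₁.im_ne_zero] at h1
  exact UpperHalfPlane.ext_re_im h1.symm h3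

theorem exists_lin_eq {w₀ w₁ : ℍ} (hne : w₀ ≠ w₁) : ∃ v ≠ 0, lin w₀ v = lin w₁ v := by
  refine ⟨(1 / w₁.im - 1 / w₀.im, 2 * (w₁.re / w₁.im - w₀.re / w₀.im)), ?_, ?_⟩
  · rcases lin_ne_of_ne hne with h | h
    · intro h0
      have := congrArg Prod.snd h0
      simp only [Prod.snd_zero] at this
      exact h (by linarith)
    · intro h0
      exact h (congrArg Prod.fst h0)
  · have h1 := w₀.im_ne_zero
    have h2 := w₁.im_ne_zero
    simp only [lin]
    field_simp
    ring

/-- Strict convexity of the hyperboloid: of three points at the same distance from `p`, no two lie in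
the same direction as seen from the third. -/
theorem eq_or_eq_of_lin_le {w₀ w₁ w₂ : ℍ} {p : ℝ × ℝ} (hne : w₀ ≠ w₁) (h1 : aff w₀ p = aff w₁ p)
    (h2 : aff w₀ p = aff w₂ p) (h : ∀ v, lin w₀ v < lin w₁ v → lin w₀ v ≤ lin w₂ v) :
    w₂ = w₀ ∨ w₂ = w₁ := by
  have hlin (w : ℍ) (v : ℝ × ℝ) : lin w v = v.2 * (1 / w.im) - 2 * v.1 * (w.re / w.im) := by
    simp only [lin]; ring
  have haff (w : ℍ) (p : ℝ × ℝ) : aff w p =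
      p.2 * (1 / w.im) - 2 * p.1 * (w.re / w.im) + (w.re ^ 2 + w.im ^ 2) / w.im := by
    simp only [aff]; ring
  -- A point w is read as (C, M, N) = (1 / Im w, Re w / Im w, |w|² / Im w) on the hyperboloid C N -
  -- M² = 1; `lin` and `aff` are linear in these coordinates.
  have hQ (w : ℍ) : (1 / w.im) * ((w.re ^ 2 + w.im ^ 2) / w.im) - (w.re / w.im) ^ 2 = 1 := by
    have := w.im_ne_zero
    field_simp
    ring
  have hinj (w w' : ℍ) (hC : 1 / w.im = 1 / w'.im) (hM : w.re / w.im = w'.re / w'.im) :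
      w = w' := by
    by_contra hcon
    rcases lin_ne_of_ne hcon with h | h
    · exact h (by rw [hM]; ring)
    · exact h (by rw [hC]; ring)
  have hD := lin_ne_of_ne hne
  simp only [hlin] at h
  simp only [haff] at h1 h2
  have Q0 := hQ w₀
  have Q1 := hQ w₁
  have Q2 := hQ w₂
  have i0 := hinj w₂ w₀
  have i1 := hinj w₂ w₁
  have hneg : (1 / w₁.im - 1 / w₀.im) * ((w₁.re ^ 2 + w₁.im ^ 2) / w₁.im -
      (w₀.re ^ 2 + w₀.im ^ 2) / w₀.im) - (w₁.re / w₁.im - w₀.re / w₀.im) ^ 2 ≠ 0 := by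
    have e : (1 / w₁.im - 1 / w₀.im) * ((w₁.re ^ 2 + w₁.im ^ 2) / w₁.im -
      (w₀.re ^ 2 + w₀.im ^ 2) / w₀.im) - (w₁.re / w₁.im - w₀.re / w₀.im) ^ 2 =
        -((w₁.re - w₀.re) ^ 2 + (w₁.im - w₀.im) ^ 2) / (w₀.im * w₁.im) := by
      have := w₀.im_ne_zero
      have := w₁.im_ne_zero
      field_simp
      ring
    rw [e]
    refine div_ne_zero (neg_ne_zero.2 fun h0 => hne ?_)
      (mul_ne_zero w₀.im_ne_zero w₁.im_ne_zero)
    apply UpperHalfPlane.ext_re_im <;> nlinarith [sq_nonneg (w₁.re - w₀.re),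
      sq_nonneg (w₁.im - w₀.im)]
  generalize 1 / w₀.im = C0 at *
  generalize 1 / w₁.im = C1 at *
  generalize 1 / w₂.im = C2 at *
  generalize w₀.re / w₀.im = M0 at *
  generalize w₁.re / w₁.im = M1 at *
  generalize w₂.re / w₂.im = M2 at *
  generalize (w₀.re ^ 2 + w₀.im ^ 2) / w₀.im = N0 at *
  generalize (w₁.re ^ 2 + w₁.im ^ 2) / w₁.im = N1 at *
  generalize (w₂.re ^ 2 + w₂.im ^ 2) / w₂.im = N2 at *
  have hpos : 0 < (M1 - M0) ^ 2 + (C1 - C0) ^ 2 := by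
    rcases hD with h | h <;> positivity
  set a := M1 - M0 with ha
  set c := C1 - C0 with hc
  -- the two linear forms are proportional
  have hdet : (M2 - M0) * c - (C2 - C0) * a = 0 := by
    by_contra hdet
    set D := (M2 - M0) * c - (C2 - C0) * a with hDdef
    set E := (M2 - M0) * a + (C2 - C0) * c with hEdef
    -- The direction is chosen so that the form of `w₁` minus that of `w₀` is a² + c² > 0, while the
    -- form of `w₂` minus that of `w₀` is E - (E + 1) = -1.
    have := h (-(a + (-(E + 1) / D) * c) / 2, c - (-(E + 1) / D) * a) (by
      simp only
      have : (c - -(E + 1) / D * a) * C1 - 2 * (-(a + -(E + 1) / D * c) / 2) * M1 -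
        ((c - -(E + 1) / D * a) * C0 - 2 * (-(a + -(E + 1) / D * c) / 2) * M0) =
          a ^ 2 + c ^ 2 := by rw [ha, hc]; ring
      linarith)
    simp only at this
    have e : (c - -(E + 1) / D * a) * C2 - 2 * (-(a + -(E + 1) / D * c) / 2) * M2 -
        ((c - -(E + 1) / D * a) * C0 - 2 * (-(a + -(E + 1) / D * c) / 2) * M0) =
          E + (-(E + 1) / D) * D := by rw [hDdef, hEdef]; ring
    rw [div_mul_cancel₀ _ hdet] at e
    linarith
  obtain ⟨l, hlM, hlC⟩ : ∃ l, M2 - M0 = l * a ∧ C2 - C0 = l * c := by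
    refine ⟨((M2 - M0) * a + (C2 - C0) * c) / (a ^ 2 + c ^ 2), ?_, ?_⟩
    · rw [div_mul_eq_mul_div, eq_div_iff hpos.ne']; linear_combination c * hdet
    · rw [div_mul_eq_mul_div, eq_div_iff hpos.ne']; linear_combination -a * hdet
  have hlN : N2 - N0 = l * (N1 - N0) := by
    linear_combination (-h2) + l * h1 - p.2 * hlC + 2 * p.1 * hlM + l * p.2 * hc - 2 * l * p.1 * ha
  -- `w₂` is now the point with parameter l on the line through `w₀` and `w₁`. By `hneg` this line
  -- is not isotropic, so it meets the hyperboloid only at l = 0 and l = 1.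
  have hll : (l * (l - 1)) * (c * (N1 - N0) - a ^ 2) = 0 := by
    obtain rfl : M2 = M0 + l * a := by linarith
    obtain rfl : C2 = C0 + l * c := by linarith
    obtain rfl : N2 = N0 + l * (N1 - N0) := by linarith
    have e1 : M1 = M0 + a := by linarith
    have e2 : C1 = C0 + c := by linarith
    rw [e1, e2] at Q1
    linear_combination Q2 - l * Q1 + (l - 1) * Q0
  rcases mul_eq_zero.1 hll with h0 | h0
  · rcases mul_eq_zero.1 h0 with rfl | h0
    · exact Or.inl (i0 (by linarith) (by linarith))
    · obtain rfl : l = 1 := by linarith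
      exact Or.inr (i1 (by linarith) (by linarith))
  · exact absurd h0 hneg

/-- No vertices: at most two tiles meet at a point, and then they share a side. -/
theorem HasTreeSides.exists_pair (hG : HasTreeSides G) {p : ℝ × ℝ} (hp : p ∈ para) :
    ∃ k₀ k₁, (k₀ ≠ k₁ → k₀⁻¹ * k₁ ∈ sideLabels G) ∧
      ∀ k ∈ G, p ∈ cell G k → k = k₀ ∨ k = k₁ := by
  have := hG.discrete
  set K : Set SL(2, ℝ) := {k | k ∈ G ∧ p ∈ cell G k} with hK
  have hfin : K.Finite := finite_cells hp
  obtain ⟨k₀, hk₀, k', hleaf⟩ := hG.leaf K hfin (exists_mem_cell hp) fun k hk => hk.1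
  by_cases hsub : ∀ k ∈ K, k = k₀
  · exact ⟨k₀, k₀, fun h => absurd rfl h, fun k h1 h2 => Or.inl (hsub k ⟨h1, h2⟩)⟩
  obtain ⟨k₁, hk₁, hne, honly⟩ : ∃ k₁ ∈ K, k₀ ≠ k₁ ∧
      ∀ k ∈ K, k ≠ k₁ → k₀⁻¹ * k ∉ sideLabels G := by
    by_cases hk' : k' ∈ K ∧ k₀ ≠ k'
    · exact ⟨k', hk'.1, hk'.2, fun k hk hkk hs => hkk (hleaf k hk hs)⟩
    · push Not at hsub
      obtain ⟨k, hk, hkk⟩ := hsub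
      refine ⟨k, hk, hkk.symm, fun l hl _ hs => hk' ?_⟩
      obtain rfl := hleaf l hl hs
      refine ⟨hl, ?_⟩
      rintro rfl
      exact hs.2.1 (inv_mul_cancel k₀)
  have heq (k : SL(2, ℝ)) (hk : k ∈ K) : aff (k₀ • I) p = aff (k • I) p :=
    aff_eq_of_mem_cell hk₀.1 hk.1 hk₀.2 hk.2
  have hIne (k : SL(2, ℝ)) (hk : k ∈ K) (h : k₀ ≠ k) : k₀ • I ≠ k • I := fun h' =>
    h (hG.eq_of_smul_eq hk₀.1 hk.1 h')
  -- In the half-plane U of directions favouring `k₀` over `k₁`, each direction points into `k₀`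
  -- (the set A) or into a third tile (the set B). U is connected and A, B are closed; if both met
  -- U, some direction would lie in both, giving `k₀` a second neighbour. So `k₀` fills all of U,
  -- and strict convexity excludes a third tile.
  have hall : ∀ k ∈ K, k = k₀ ∨ k = k₁ := by
    set U : Set (ℝ × ℝ) := {v | lin (k₀ • I) v < lin (k₁ • I) v} with hU
    set A : Set (ℝ × ℝ) := {v | ∀ k ∈ K, lin (k₀ • I) v ≤ lin (k • I) v} with hA
    set B : Set (ℝ × ℝ) := ⋃ k ∈ K \ {k₀, k₁},
      {v | ∀ k' ∈ K, lin (k • I) v ≤ lin (k' • I) v} with hB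
    have hcl (k : SL(2, ℝ)) : IsClosed {v | ∀ k' ∈ K, lin (k • I) v ≤ lin (k' • I) v} := by
      have e : {v | ∀ k' ∈ K, lin (k • I) v ≤ lin (k' • I) v} =
          ⋂ k' ∈ K, {v | lin (k • I) v ≤ lin (k' • I) v} := by ext; simp
      rw [e]
      exact isClosed_biInter fun k' _ => isClosed_le (by fun_prop) (by fun_prop)
    have hBcl : IsClosed B := (hfin.subset Set.sdiff_subset).isClosed_biUnion fun k _ => hcl k
    have hUconv : Convex ℝ U := by
      intro v hv v' hv' a b ha hb hab
      simp only [hU, Set.mem_ofPred_eq, lin_comb] at *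
      rcases ha.eq_or_lt with rfl | ha
      · obtain rfl : b = 1 := by linarith
        simpa using hv'
      · nlinarith
    have hcover : U ⊆ A ∪ B := by
      intro v hv
      obtain ⟨k, hk, hmin⟩ := hfin.exists_minimalFor (fun k => lin (k • I) v) K ⟨k₀, hk₀⟩
      have hmin' : ∀ k' ∈ K, lin (k • I) v ≤ lin (k' • I) v := fun k' hk' =>
        (le_total _ _).elim id fun h => hmin hk' h
      by_cases h0 : k = k₀
      · exact Or.inl fun k' hk' => by simpa only [h0] using hmin' k' hk'
      · right
        refine Set.mem_biUnion (x := k) ⟨hk, ?_⟩ hmin'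
        rintro (h | h)
        · exact h0 h
        · rw [h] at hmin'
          exact absurd (hmin' k₀ hk₀) (not_le.2 hv)
    have hUA : (U ∩ A).Nonempty := by
      have hlt (k : SL(2, ℝ)) (hk : k ∈ K) (h : k₀ ≠ k) :
          lin (k₀ • I) (proj (k₀ • I) - p) < lin (k • I) (proj (k₀ • I) - p) := by
        rw [lin_sub, lin_sub, heq k hk, sub_lt_sub_iff_right, aff_proj, aff_proj,
          mul_lt_mul_iff_right₀ (by have := (k₀ • I).im_pos; positivity), Real.cosh_lt_cosh,
          dist_self, abs_zero]
        exact abs_pos.2 (dist_ne_zero.2 (hIne k hk h))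
      refine ⟨_, hlt k₁ hk₁ hne, fun k hk => ?_⟩
      by_cases h : k₀ = k
      · rw [h]
      · exact (hlt k hk h).le
    have hUB : ¬ (U ∩ B).Nonempty := by
      intro hUB
      obtain ⟨v, hvU, hvA, hvB⟩ := isPreconnected_closed_iff.1 hUconv.isPreconnected A B (hcl k₀)
        hBcl hcover hUA hUB
      simp only [hB, Set.mem_iUnion] at hvB
      obtain ⟨k, ⟨hk, hkk⟩, hkv⟩ := hvB
      simp only [Set.mem_insert_iff, Set.mem_singleton_iff, not_or] at hkk
      refine honly k hk hkk.2 (mem_sideLabels_of_direction hk₀.1 hk.1 (Ne.symm hkk.1) hk₀.2 hk.2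
        (v := v) ?_ (fun g h h' => hvA g ⟨h, h'⟩) (fun g h h' => hkv g ⟨h, h'⟩))
      rintro rfl
      simp [hU, lin] at hvU
    intro k hk
    have := eq_or_eq_of_lin_le (hIne k₁ hk₁ hne) (heq k₁ hk₁) (heq k hk) fun v hv =>
      (hcover hv).elim (fun h => h k hk) fun h => absurd ⟨v, hv, h⟩ hUB
    exact this.imp (hG.eq_of_smul_eq hk.1 hk₀.1) (hG.eq_of_smul_eq hk.1 hk₁.1)
  refine ⟨k₀, k₁, fun _ => ?_, fun k h1 h2 => hall k ⟨h1, h2⟩⟩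
  obtain ⟨v, hv, hvl⟩ := exists_lin_eq (hIne k₁ hk₁ hne)
  refine mem_sideLabels_of_direction hk₀.1 hk₁.1 hne hk₀.2 hk₁.2 hv ?_ ?_ <;>
  · intro g hg hpg
    rcases hall g ⟨hg, hpg⟩ with rfl | rfl
    · simp [hvl]
    · simp [hvl]

theorem HasTreeSides.mem_sideLabels (hG : HasTreeSides G) {p : ℝ × ℝ} {k k' : SL(2, ℝ)}
    (hk : k ∈ G) (hk' : k' ∈ G) (hne : k ≠ k') (h : p ∈ cell G k) (h' : p ∈ cell G k') :
    k⁻¹ * k' ∈ sideLabels G := by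
  obtain ⟨k₀, k₁, hs, hall⟩ := hG.exists_pair h.1
  have hinv (hs : k₀⁻¹ * k₁ ∈ sideLabels G) : k₁⁻¹ * k₀ ∈ sideLabels G := by
    simpa using inv_mem_sideLabels hs
  rcases hall k hk h with rfl | rfl <;> rcases hall k' hk' h' with rfl | rfl
  · exact absurd rfl hne
  · exact hs hne
  · exact hinv (hs hne.symm)
  · exact absurd rfl hne

theorem HasTreeSides.eq_or_eq (hG : HasTreeSides G) {p : ℝ × ℝ} {k k' l : SL(2, ℝ)}
    (hk : k ∈ G) (hk' : k' ∈ G) (hl : l ∈ G) (hne : k ≠ k') (h : p ∈ cell G k)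
    (h' : p ∈ cell G k') (hpl : p ∈ cell G l) : l = k ∨ l = k' := by
  obtain ⟨k₀, k₁, -, hall⟩ := hG.exists_pair h.1
  rcases hall k hk h with rfl | rfl <;> rcases hall k' hk' h' with rfl | rfl <;>
    rcases hall l hl hpl with rfl | rfl <;> simp_all

/-- The common side of two tiles is the whole bisector. -/
theorem HasTreeSides.mem_cell_of_bisector (hG : HasTreeSides G) {p q : ℝ × ℝ} {k k' : SL(2, ℝ)}
    (hk : k ∈ G) (hk' : k' ∈ G) (hne : k ≠ k') (h : p ∈ cell G k) (h' : p ∈ cell G k')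
    (hq : q ∈ para) (heq : aff (k • I) q = aff (k' • I) q) : q ∈ cell G k := by
  have := hG.discrete
  have hpara (t : ℝ) (ht : t ∈ Set.Icc (0 : ℝ) 1) : p + t • (q - p) ∈ para :=
    convex_para.add_smul_sub_mem h.1 hq ht
  have hbis (t : ℝ) : aff (k • I) (p + t • (q - p)) = aff (k' • I) (p + t • (q - p)) := by
    rw [aff_add_smul, aff_add_smul, lin_sub, lin_sub, heq, aff_eq_of_mem_cell hk hk' h h']
  have hcont : Continuous fun t : ℝ => p + t • (q - p) := by fun_prop
  set s : Set ℝ := {t | ∀ g ∈ G, aff (k • I) (p + t • (q - p)) ≤ aff (g • I) (p + t • (q - p))}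
    with hs
  have hscl : IsClosed s := by
    have e : s = ⋂ g ∈ G, {t : ℝ | aff (k • I) (p + t • (q - p)) ≤
      aff (g • I) (p + t • (q - p))} := by ext; simp [hs]
    rw [e]
    exact isClosed_biInter fun g _ => isClosed_le ((continuous_aff _).comp hcont)
      ((continuous_aff _).comp hcont)
  -- Continuous induction along the segment: at a point of the bisector lying in both tiles there is
  -- no third tile, so the inequalities persist a little further.
  have hsub : Set.Icc (0 : ℝ) 1 ⊆ s := by
    refine IsClosed.Icc_subset_of_forall_mem_nhdsWithin (hscl.inter isClosed_Icc) ?_ ?_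
    · simpa [hs] using h.2
    · rintro t ⟨ht, ht1⟩
      have hmem : p + t • (q - p) ∈ cell G k := ⟨hpara t ⟨ht1.1, ht1.2.le⟩, ht⟩
      have hmem' : p + t • (q - p) ∈ cell G k' :=
        ⟨hmem.1, fun g hg => (hbis t).symm.le.trans (ht g hg)⟩
      have := (hcont.tendsto t).eventually (eventually_mem_cell_of_le (G := G) hmem.1)
      refine (this.filter_mono nhdsWithin_le_nhds).mono fun t' ht' => ?_
      refine (ht' k fun g hg hpg => ?_).2
      rcases hG.eq_or_eq hk hk' hg hne hmem hmem' hpg with rfl | rfl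
      · rfl
      · exact (hbis t').le
  have := hsub (Set.right_mem_Icc.2 zero_le_one)
  refine ⟨hq, ?_⟩
  simpa [hs] using this


/-! ### The Cayley tree of the free group. -/

section FreeGroup

variable {α : Type*} [DecidableEq α]

/-- In the Cayley tree of a free group a vertex has just one neighbour that is not farther from the
identity. -/
theorem mul_mk_singleton_eq_of_norm_le {w : FreeGroup α} {a : α × Bool}
    (h : (w * FreeGroup.mk [a]).norm ≤ w.norm) :
    w * FreeGroup.mk [a] = FreeGroup.mk w.toWord.dropLast := by
  by_cases hlast : w.toWord.getLast? = some (a.1, !a.2)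
  · obtain ⟨L, hL⟩ := List.getLast?_eq_some_iff.1 hlast
    conv_lhs => rw [← FreeGroup.mk_toWord (x := w)]
    rw [hL, List.dropLast_concat, ← FreeGroup.mul_mk, mul_assoc, FreeGroup.mul_mk]
    have : FreeGroup.mk ([(a.1, !a.2)] ++ [a]) = 1 := by
      rw [FreeGroup.one_eq_mk]
      exact Quot.sound (FreeGroup.Red.Step.cons_not_rev (x := a.1) (b := a.2) (L := []))
    rw [this, mul_one]
  · have hred : FreeGroup.IsReduced (w.toWord ++ [a]) := by
      refine List.isChain_append.2 ⟨FreeGroup.isReduced_toWord, List.isChain_singleton a, ?_⟩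
      intro x hx y hy hxy
      by_contra hne
      apply hlast
      simp only [List.head?_cons, Option.mem_def, Option.some.injEq] at hx hy
      subst hy
      rw [hx, Option.some.injEq]
      ext1
      · exact hxy
      · exact Bool.eq_not.2 hne
    have : (w * FreeGroup.mk [a]).toWord = w.toWord ++ [a] := by
      rw [FreeGroup.toWord_mul, FreeGroup.toWord_mk, FreeGroup.reduce_singleton, hred.reduce_eq]
    rw [FreeGroup.norm, this, FreeGroup.norm] at h
    simp at h

end FreeGroup

variable {u v : ℕ} {h : Fin u → SL(2, ℝ)} {γ : Fin v → SL(2, ℝ)}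

theorem IsFreeFuchsian.exists_mk_singleton (hG : IsFreeFuchsian G h γ) {s : SL(2, ℝ)}
    (hs : s ∈ sideLabels G) :
    ∃ a, FreeGroup.lift (Sum.elim h γ) (FreeGroup.mk [a]) = s := by
  rw [hG.sides] at hs
  simp only [symmSet] at hs
  rcases hs with (⟨i, rfl⟩ | ⟨i, rfl⟩) | (⟨i, rfl⟩ | ⟨i, rfl⟩)
  · exact ⟨(Sum.inl i, true), by simp [FreeGroup.lift_mk]⟩
  · exact ⟨(Sum.inl i, false), by simp [FreeGroup.lift_mk]⟩
  · exact ⟨(Sum.inr i, true), by simp [FreeGroup.lift_mk]⟩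
  · exact ⟨(Sum.inr i, false), by simp [FreeGroup.lift_mk]⟩

/-- A nontrivial stabiliser element would have infinitely many powers fixing i, against
discreteness. A leaf of a finite set is an element of maximal word length: its only possible
neighbour in the set is its parent in the Cayley tree. -/
theorem IsFreeFuchsian.hasTreeSides (hG : IsFreeFuchsian G h γ) : HasTreeSides G := by
  have := hG.discrete
  have hran (k : SL(2, ℝ)) (hk : k ∈ G) : ∃ w, FreeGroup.lift (Sum.elim h γ) w = k := by
    rwa [← hG.generates] at hk
  refine ⟨hG.discrete, fun k hk hkI => ?_, fun K hfin hne hK => ?_⟩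
  · obtain ⟨w, rfl⟩ := hran k hk
    by_contra hw
    have hw1 : w ≠ 1 := by rintro rfl; simp at hw
    have hinj : Function.Injective fun n : ℕ => FreeGroup.lift (Sum.elim h γ) w ^ n := by
      have h1 := injective_pow_iff_not_isOfFinOrder.2 (not_isOfFinOrder_of_isMulTorsionFree hw1)
      intro m n hmn
      simp only [← map_pow] at hmn
      exact h1 (hG.free hmn)
    refine Set.infinite_range_of_injective hinj ((finite_orbit_ball (G := G) 0).subset ?_)
    rintro _ ⟨n, rfl⟩
    refine ⟨pow_mem hk n, le_of_eq ?_⟩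
    rw [dist_eq_zero]
    induction n with
    | zero => simp
    | succ n ih =>
      beta_reduce at ih ⊢
      rw [pow_succ, mul_smul, hkI, ← ih]
  · have hfin' : (FreeGroup.lift (Sum.elim h γ) ⁻¹' K).Finite := hfin.preimage hG.free.injOn
    have hne' : (FreeGroup.lift (Sum.elim h γ) ⁻¹' K).Nonempty := by
      obtain ⟨k, hk⟩ := hne
      obtain ⟨w, rfl⟩ := hran k (hK hk)
      exact ⟨w, hk⟩
    obtain ⟨w, hw, hmax⟩ := hfin'.exists_maximalFor FreeGroup.norm _ hne'
    refine ⟨_, hw, FreeGroup.lift (Sum.elim h γ) (FreeGroup.mk w.toWord.dropLast),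
      fun k hk hs => ?_⟩
    obtain ⟨a, ha⟩ := hG.exists_mk_singleton hs
    have hk' : k = FreeGroup.lift (Sum.elim h γ) (w * FreeGroup.mk [a]) := by
      rw [map_mul, ha, mul_inv_cancel_left]
    rw [hk', mul_mk_singleton_eq_of_norm_le]
    have hmem : w * FreeGroup.mk [a] ∈ FreeGroup.lift (Sum.elim h γ) ⁻¹' K := by
      rwa [Set.mem_preimage, ← hk']
    exact (le_total _ _).elim id fun h' => hmax hmem h'


/-! ### Cusp charts of parabolic elements. -/

theorem re_smul_eq (g : SL(2, ℝ)) (z : ℍ) : (g • z).re =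
    ((g 0 0 * z.re + g 0 1) * (g 1 0 * z.re + g 1 1) + g 0 0 * g 1 0 * z.im ^ 2) /
      ((g 1 0 * z.re + g 1 1) ^ 2 + (g 1 0 * z.im) ^ 2) := by
  rw [← coe_re, coe_specialLinearGroup_apply, Complex.div_re, Complex.normSq_apply]
  simp
  rw [← add_div]
  congr 1 <;> ring

theorem im_smul_eq (g : SL(2, ℝ)) (z : ℍ) : (g • z).im =
    z.im / ((g 1 0 * z.re + g 1 1) ^ 2 + (g 1 0 * z.im) ^ 2) := by
  have hdet : g 0 0 * g 1 1 - g 0 1 * g 1 0 = 1 := by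
    have := g.det_coe
    rwa [Matrix.det_fin_two] at this
  rw [← coe_im, coe_specialLinearGroup_apply, Complex.div_im, Complex.normSq_apply]
  simp
  rw [← sub_div]
  congr 1
  · linear_combination z.im * hdet
  · ring

theorem smul_denom_pos (g : SL(2, ℝ)) (z : ℍ) :
    0 < (g 1 0 * z.re + g 1 1) ^ 2 + (g 1 0 * z.im) ^ 2 := by
  have h1 := (g • z).im_pos
  rw [im_smul_eq] at h1
  exact (div_pos_iff_of_pos_left z.im_pos).1 h1

/-- In the coordinate `A • z` the parabolic element `ω` is a horizontal translation by `±1`. -/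
def IsCuspChart (A ω : SL(2, ℝ)) : Prop :=
  ∃ e : ℝ, |e| = 1 ∧ ∀ z : ℍ, A • ω • z = e +ᵥ A • z

theorem IsCuspChart.exists_shift {A ω : SL(2, ℝ)} (hA : IsCuspChart A ω) :
    ∃ e : ℝ, |e| = 1 ∧ (∀ z : ℍ, A • ω • z = e +ᵥ A • z) ∧
      ∀ z : ℍ, A • ω⁻¹ • z = -e +ᵥ A • z := by
  obtain ⟨e, he, h⟩ := hA
  refine ⟨e, he, h, fun z => ?_⟩
  rw [← vadd_left_cancel_iff e, ← h, smul_inv_smul, vadd_vadd]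
  simp

theorem IsCuspChart.inv {A ω : SL(2, ℝ)} (hA : IsCuspChart A ω) : IsCuspChart A ω⁻¹ := by
  obtain ⟨e, he, -, h⟩ := hA.exists_shift
  exact ⟨-e, by rwa [abs_neg], h⟩

theorem vadd_smul_pow {A ω : SL(2, ℝ)} {e : ℝ} (h : ∀ z : ℍ, A • ω • z = e +ᵥ A • z) (n : ℕ)
    (z : ℍ) : A • ω ^ n • z = (n * e) +ᵥ A • z := by
  induction n with
  | zero => simp
  | succ n ih =>
    rw [pow_succ', mul_smul, h, ih, vadd_vadd]
    congr 1
    push_cast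
    ring

theorem exists_SL2_of_entries {a b c d : ℝ} (h : a * d - b * c = 1) :
    ∃ A : SL(2, ℝ), A 0 0 = a ∧ A 0 1 = b ∧ A 1 0 = c ∧ A 1 1 = d :=
  ⟨⟨!![a, b; c, d], by rw [Matrix.det_fin_two_of, h]⟩, rfl, rfl, rfl, rfl⟩

/-- The entries say B = η T A with T the translation by e. The sign η = ±1, needed because a
parabolic matrix may have trace -2, does not affect the action. -/
theorem smul_eq_vadd_smul {A B : SL(2, ℝ)} {η e : ℝ} (hη : η ^ 2 = 1)
    (h00 : B 0 0 = η * (A 0 0 + e * A 1 0)) (h01 : B 0 1 = η * (A 0 1 + e * A 1 1))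
    (h10 : B 1 0 = η * A 1 0) (h11 : B 1 1 = η * A 1 1) (z : ℍ) : B • z = e +ᵥ A • z := by
  have hden : (B 1 0 * z.re + B 1 1) ^ 2 + (B 1 0 * z.im) ^ 2 =
      (A 1 0 * z.re + A 1 1) ^ 2 + (A 1 0 * z.im) ^ 2 := by
    rw [h10, h11]
    linear_combination ((A 1 0 * z.re + A 1 1) ^ 2 + (A 1 0 * z.im) ^ 2) * hη
  apply UpperHalfPlane.ext_re_im
  · rw [vadd_re, re_smul_eq, re_smul_eq, hden, div_eq_iff (smul_denom_pos A z).ne', add_mul e,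
      div_mul_cancel₀ _ (smul_denom_pos A z).ne', h00, h01, h10, h11]
    linear_combination ((A 0 0 * z.re + A 0 1) * (A 1 0 * z.re + A 1 1)
      + A 0 0 * A 1 0 * z.im ^ 2 + e * ((A 1 0 * z.re + A 1 1) ^ 2 + (A 1 0 * z.im) ^ 2)) * hη
  · rw [vadd_im, im_smul_eq, im_smul_eq, hden]

theorem exists_isCuspChart {ω : SL(2, ℝ)} (hω : (ω : Matrix (Fin 2) (Fin 2) ℝ).IsParabolic) :
    ∃ A, IsCuspChart A ω := by
  have hdet : ω 0 0 * ω 1 1 - ω 0 1 * ω 1 0 = 1 := by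
    have := ω.det_coe
    rwa [Matrix.det_fin_two] at this
  obtain ⟨hscal, hdisc⟩ := hω
  rw [Matrix.discr_fin_two, Matrix.trace_fin_two, Matrix.det_fin_two] at hdisc
  have htr : ((ω 0 0 + ω 1 1) / 2) ^ 2 = 1 := by linarith
  have habs {x y : ℝ} (hx : x ^ 2 = 1) (hy : y ≠ 0) : abs (y * x / |y|) = 1 := by
    rw [abs_div, abs_mul, abs_abs, div_eq_one_iff_eq (abs_ne_zero.2 hy)]
    have : |x| = 1 := by
      rwa [← pow_eq_one_iff_of_nonneg (abs_nonneg _) two_ne_zero, sq_abs]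
    rw [this, mul_one]
  have hsqrt {y : ℝ} (hy : y ≠ 0) : ∃ s : ℝ, s ≠ 0 ∧ s ^ 2 = |y| :=
    ⟨√|y|, (Real.sqrt_pos.2 (abs_pos.2 hy)).ne', Real.sq_sqrt (abs_nonneg _)⟩
  have hmul (A : SL(2, ℝ)) (i j : Fin 2) : (A * ω) i j = A i 0 * ω 0 j + A i 1 * ω 1 j := by
    rw [Matrix.SpecialLinearGroup.coe_mul, Matrix.mul_apply, Fin.sum_univ_two]
  by_cases hc : ω 1 0 = 0
  · have had : ω 0 0 = ω 1 1 := by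
      rw [hc] at hdet
      nlinarith [sq_nonneg (ω 0 0 - ω 1 1)]
    have hb : ω 0 1 ≠ 0 := by
      intro hb
      apply hscal
      refine ⟨ω 0 0, ?_⟩
      ext i j
      fin_cases i <;> fin_cases j <;> simp [hc, hb, had]
    have hd : ω 1 1 ^ 2 = 1 := by rw [had, hc] at hdet; linarith
    obtain ⟨s, hs0, hs⟩ := hsqrt hb
    obtain ⟨A, h00, h01, h10, h11⟩ := exists_SL2_of_entries (a := s⁻¹) (b := 0) (c := 0) (d := s)
      (by simp [hs0])
    refine ⟨A, ω 0 1 * ω 1 1 / |ω 0 1|, habs hd hb, fun z => ?_⟩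
    rw [← mul_smul]
    apply smul_eq_vadd_smul hd <;> rw [hmul] <;> simp only [h00, h01, h10, h11, hc, had]
    · ring
    · rw [← hs]
      field_simp
      linear_combination -ω 0 1 * hd
    · ring
    · ring
  -- A is z ↦ -1 / (s² (z - p)), where p = (ω₀₀ - ω₁₁) / (2 ω₁₀) is the fixed point and s² = |ω₁₀|
  -- makes the translation length one.
  · obtain ⟨s, hs0, hs⟩ := hsqrt hc
    obtain ⟨A, h00, h01, h10, h11⟩ := exists_SL2_of_entries (a := 0) (b := -s⁻¹) (c := s)
      (d := -s * ((ω 0 0 - ω 1 1) / (2 * ω 1 0))) (by field_simp; ring)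
    refine ⟨A, -ω 1 0 * ((ω 0 0 + ω 1 1) / 2) / |-ω 1 0|, habs htr (neg_ne_zero.2 hc),
      fun z => ?_⟩
    rw [← mul_smul, abs_neg, ← hs]
    apply smul_eq_vadd_smul htr <;> rw [hmul] <;> simp only [h00, h01, h10, h11]
    · field_simp
      linear_combination 4 * ω 1 0 * htr
    · field_simp
      linear_combination (-4 * (ω 0 0 - ω 1 1)) * htr
    · field_simp
      ring
    · field_simp
      linear_combination hdisc


/-! ### Sides and horoballs of the Dirichlet domain in cusp charts. -/

theorem dist_le_dist_iff' (z w w' : ℍ) : dist z w ≤ dist z w' ↔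
    w'.im * ((z.re - w.re) ^ 2 + z.im ^ 2 + w.im ^ 2) ≤
      w.im * ((z.re - w'.re) ^ 2 + z.im ^ 2 + w'.im ^ 2) := by
  have h0 := z.im_pos
  have h1 := w.im_pos
  have h2 := w'.im_pos
  rw [← abs_of_nonneg (dist_nonneg (x := z) (y := w)),
    ← abs_of_nonneg (dist_nonneg (x := z) (y := w')), ← Real.cosh_le_cosh, cosh_dist_eq,
    cosh_dist_eq, div_le_div_iff₀ (by positivity) (by positivity),
    ← mul_le_mul_iff_right₀ (a := 2 * z.im) (b := w'.im * _) (by positivity)]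
  constructor <;> intro h <;> linarith

theorem dist_eq_dist_iff' (z w w' : ℍ) : dist z w = dist z w' ↔
    w'.im * ((z.re - w.re) ^ 2 + z.im ^ 2 + w.im ^ 2) =
      w.im * ((z.re - w'.re) ^ 2 + z.im ^ 2 + w'.im ^ 2) := by
  simp only [le_antisymm_iff, dist_le_dist_iff']

/-- A point of the bisector of `w₀` and `w₁` has height at most `1 / 2` if this bisector is contained
in the strip of width one about `w₀`, and no boundary point of the strip is closer to `w₁`. -/
theorem im_le_half_of_bisector {w₀ w₁ : ℍ} (hne : w₁ ≠ w₀)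
    (hP : ∀ z : ℍ, dist z w₀ = dist z w₁ → |z.re - w₀.re| ≤ 1 / 2)
    (hQ : ∀ z : ℍ, |z.re - w₀.re| = 1 / 2 → dist z w₀ ≤ dist z w₁)
    (htrans : ∀ e : ℝ, |e| = 1 → w₁ ≠ e +ᵥ w₀) {z : ℍ} (hz : dist z w₀ = dist z w₁) :
    z.im ≤ 1 / 2 := by
  have mkpt (x y : ℝ) (hy : 0 < y) : ∃ z : ℍ, z.re = x ∧ z.im = y := ⟨⟨⟨x, y⟩, hy⟩, rfl, rfl⟩
  have p0 := w₀.im_pos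
  have p1 := w₁.im_pos
  simp only [dist_eq_dist_iff', dist_le_dist_iff'] at hP hQ hz
  by_cases him : w₁.im = w₀.im
  -- The bisector is vertical; `hP` and `hQ` force the horizontal distance to be exactly one, which
  -- `htrans` excludes.
  · exfalso
    have hre : w₁.re ≠ w₀.re := fun h => hne (UpperHalfPlane.ext_re_im h him)
    obtain ⟨z₁, hz₁, -⟩ := mkpt ((w₀.re + w₁.re) / 2) 1 one_pos
    have h1 := hP z₁ (by rw [hz₁, him]; ring)
    rw [hz₁, abs_le] at h1
    have key (s : ℝ) (hs : |s| = 1) (hpos : 0 < s * (w₁.re - w₀.re)) : False := by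
      have hs2 : s ^ 2 = 1 := by rw [← sq_abs, hs]; norm_num
      obtain ⟨z₂, hz₂, -⟩ := mkpt (w₀.re + s / 2) 1 one_pos
      have h2 := hQ z₂ (by rw [hz₂, add_sub_cancel_left, abs_div, hs]; norm_num)
      rw [hz₂, him, mul_le_mul_iff_right₀ p0] at h2
      have h3 : s * (w₁.re - w₀.re) ≤ (w₁.re - w₀.re) ^ 2 := by nlinarith
      have h4 : (s * (w₁.re - w₀.re)) ^ 2 = (w₁.re - w₀.re) ^ 2 := by
        linear_combination (w₁.re - w₀.re) ^ 2 * hs2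
      have h5 : 1 ≤ s * (w₁.re - w₀.re) := by
        rw [← h4] at h3
        nlinarith
      have h6 : s * (w₁.re - w₀.re) ≤ 1 := by
        have : (w₁.re - w₀.re) ^ 2 ≤ 1 := by nlinarith
        rw [← h4] at this
        nlinarith
      refine htrans s hs (UpperHalfPlane.ext_re_im ?_ (by rw [vadd_im, him]))
      rw [vadd_re]
      linear_combination (w₀.re - w₁.re) * hs2 + s * (le_antisymm h6 h5)
    rcases lt_or_gt_of_ne hre with h | h
    · exact key (-1) (by simp) (by linarith)
    · exact key 1 (by simp) (by linarith)
  · by_contra! hlt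
    have hv : w₁.im - w₀.im ≠ 0 := sub_ne_zero.2 him
    -- The bisector is a semicircle with centre m and squared radius R. If R > 1/4, it has points m
    -- ± r with r > 1/2, too far apart for the strip.
    obtain ⟨m, hm⟩ : ∃ m, m * (w₁.im - w₀.im) = w₁.im * w₀.re - w₀.im * w₁.re :=
      ⟨_, div_mul_cancel₀ _ hv⟩
    set R := (z.re - m) ^ 2 + z.im ^ 2 with hR
    have hR4 : 1 / 4 < R := by nlinarith [sq_nonneg (z.re - m)]
    have hcirc (x y : ℝ) (hxy : (x - m) ^ 2 + y ^ 2 = R) :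
        w₁.im * ((x - w₀.re) ^ 2 + y ^ 2 + w₀.im ^ 2) =
          w₀.im * ((x - w₁.re) ^ 2 + y ^ 2 + w₁.im ^ 2) := by
      rw [hR] at hxy
      linear_combination hz + (w₁.im - w₀.im) * hxy + 2 * (x - z.re) * hm
    obtain ⟨r, hr, hr2⟩ : ∃ r, 1 / 2 < r ∧ r ^ 2 = (R + 1 / 4) / 2 := by
      refine ⟨√((R + 1 / 4) / 2), Real.lt_sqrt_of_sq_lt (by linarith), Real.sq_sqrt (by linarith)⟩
    obtain ⟨y, hy, hy2⟩ : ∃ y, 0 < y ∧ y ^ 2 = (R - 1 / 4) / 2 :=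
      ⟨√((R - 1 / 4) / 2), Real.sqrt_pos.2 (by linarith), Real.sq_sqrt (by linarith)⟩
    obtain ⟨z₁, h1, h1'⟩ := mkpt (m + r) y hy
    obtain ⟨z₂, h2, h2'⟩ := mkpt (m - r) y hy
    have e1 := hP z₁ (by rw [h1, h1']; exact hcirc _ _ (by linarith))
    have e2 := hP z₂ (by rw [h2, h2']; exact hcirc _ _ (by linarith))
    rw [h1, abs_le] at e1
    rw [h2, abs_le] at e2
    linarith

theorem proj_mem_cell_one_iff (z : ℍ) : proj z ∈ cell G 1 ↔ z ∈ dirichletDomain G := by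
  rw [proj_mem_cell_iff G.one_mem, one_smul]

/-- The sides of the Dirichlet domain are complete geodesics. -/
theorem HasTreeSides.mem_dirichletDomain_of_bisector (hG : HasTreeSides G) {ω : SL(2, ℝ)}
    (hω : ω ∈ sideLabels G) {z : ℍ} (hz : dist z I = dist z (ω • I)) :
    z ∈ dirichletDomain G := by
  obtain ⟨hωG, hω1, p, ⟨hp, hp'⟩, -⟩ := hω
  rw [← proj_mem_cell_one_iff] at hp ⊢
  rw [← proj_mem_cell_iff hωG] at hp'
  refine hG.mem_cell_of_bisector G.one_mem hωG hω1.symm hp hp' (proj_mem_para z) ?_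
  rwa [one_smul, ← dist_eq_dist_iff]

theorem dist_eq_of_mem_inter {ω : SL(2, ℝ)} (hω : ω ∈ G) {z : ℍ}
    (hz : z ∈ dirichletDomain G ∩ ω • dirichletDomain G) : dist z I = dist z (ω • I) := by
  refine le_antisymm (hz.1 ω hω) ?_
  have := (mem_smul_dirichletDomain_iff hω z).1 hz.2 1 G.one_mem
  rwa [one_smul] at this

section Cusp

variable {A ω : SL(2, ℝ)}

/-- The Dirichlet domain lies in the strip of width one about the image of `i` in a cusp chart. -/
theorem abs_re_sub_le_half (hA : IsCuspChart A ω) (hω : ω ∈ G) {z : ℍ}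
    (hz : z ∈ dirichletDomain G) : |(A • z).re - (A • I).re| ≤ 1 / 2 := by
  have aux (e : ℝ) (h : dist (A • z) (A • I) ≤ dist (A • z) (e +ᵥ A • I)) :
      ((A • z).re - (A • I).re) ^ 2 ≤ ((A • z).re - (A • I).re - e) ^ 2 := by
    rw [dist_le_dist_iff', vadd_im, vadd_re, mul_le_mul_iff_right₀ (A • I).im_pos] at h
    nlinarith
  have hmove (g : SL(2, ℝ)) (hg : g ∈ G) (e : ℝ) (h : A • g • I = e +ᵥ A • I) :
      dist (A • z) (A • I) ≤ dist (A • z) (e +ᵥ A • I) := by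
    rw [← h, dist_smul, dist_smul]
    exact hz g hg
  obtain ⟨e, he, h, h'⟩ := hA.exists_shift
  have he2 : e ^ 2 = 1 := by rw [← sq_abs, he]; norm_num
  have h1 := aux e (hmove ω hω e (h I))
  have h2 := aux (-e) (hmove ω⁻¹ (inv_mem hω) (-e) (h' I))
  have h3 : |((A • z).re - (A • I).re) * e| ≤ 1 / 2 := abs_le.2 ⟨by nlinarith, by nlinarith⟩
  rwa [abs_mul, he, mul_one] at h3

/-- The boundary lines of the strip are the bisectors of i and ω^{±1} i, hence complete sides of F.
-/
theorem HasTreeSides.mem_dirichletDomain_of_abs_re (hG : HasTreeSides G) (hA : IsCuspChart A ω)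
    (hω : ω ∈ sideLabels G) {z : ℍ} (hz : |(A • z).re - (A • I).re| = 1 / 2) :
    z ∈ dirichletDomain G := by
  obtain ⟨e, he, h, h'⟩ := hA.exists_shift
  have aux (e : ℝ) (he : |e| = 1) (hz : (A • z).re - (A • I).re = e / 2) :
      dist (A • z) (A • I) = dist (A • z) (e +ᵥ A • I) := by
    rw [dist_eq_dist_iff', vadd_im, vadd_re]
    congr 3
    linear_combination 2 * e * hz
  have hcases : (A • z).re - (A • I).re = e / 2 ∨ (A • z).re - (A • I).re = -e / 2 := by
    rcases abs_cases ((A • z).re - (A • I).re) with ⟨h1, -⟩ | ⟨h1, -⟩ <;>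
    rcases abs_cases e with ⟨h2, -⟩ | ⟨h2, -⟩
    · left; linarith
    · right; linarith
    · right; linarith
    · left; linarith
  rcases hcases with hc | hc
  · apply hG.mem_dirichletDomain_of_bisector hω
    rw [← dist_smul A, ← dist_smul A z (ω • I), h]
    exact aux e he hc
  · apply hG.mem_dirichletDomain_of_bisector (inv_mem_sideLabels hω)
    rw [← dist_smul A, ← dist_smul A z (ω⁻¹ • I), h']
    exact aux (-e) (by rwa [abs_neg]) hc

/-- In a cusp chart the other sides of the Dirichlet domain are low. -/
theorem HasTreeSides.im_smul_le_half (hG : HasTreeSides G) (hA : IsCuspChart A ω)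
    (hω : ω ∈ sideLabels G) {ω' : SL(2, ℝ)} (hω' : ω' ∈ sideLabels G) (hne : ω' ≠ ω)
    (hne' : ω' ≠ ω⁻¹) {z : ℍ} (hz : dist z I = dist z (ω' • I)) : (A • z).im ≤ 1 / 2 := by
  have hd (z : ℍ) (w : ℍ) : dist z (A • w) = dist (A⁻¹ • z) w := by
    rw [← dist_smul A (A⁻¹ • z), smul_inv_smul]
  have hinj (g : SL(2, ℝ)) (hg : g ∈ G) (h : A • ω' • I = A • g • I) : ω' = g :=
    hG.eq_of_smul_eq hω'.1 hg (smul_left_cancel _ h)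
  refine im_le_half_of_bisector (w₀ := A • I) (w₁ := A • ω' • I) ?_ ?_ ?_ ?_ ?_
  · exact fun h => hω'.2.1 (hinj 1 G.one_mem (by rwa [one_smul]))
  · intro z hz
    rw [hd, hd] at hz
    simpa using abs_re_sub_le_half hA hω.1 (hG.mem_dirichletDomain_of_bisector hω' hz)
  · intro z hz
    rw [hd, hd]
    refine hG.mem_dirichletDomain_of_abs_re hA hω ?_ ω' hω'.1
    simpa using hz
  · intro e he h
    obtain ⟨e₁, he₁, h₁, h₂⟩ := hA.exists_shift
    rcases abs_eq_abs.1 (he.trans he₁.symm) with rfl | rfl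
    · exact hne (hinj ω hω.1 (by rw [h, h₁]))
    · exact hne' (hinj ω⁻¹ (inv_mem hω.1) (by rw [h, h₂]))
  · rwa [dist_smul, dist_smul]

/-- The horoballs of two different cusps of the Dirichlet domain are far apart. -/
theorem HasTreeSides.im_smul_mul_im_smul_le (hG : HasTreeSides G) (hA : IsCuspChart A ω)
    (hω : ω ∈ sideLabels G) {A' ω' : SL(2, ℝ)} (hA' : IsCuspChart A' ω')
    (hω' : ω' ∈ sideLabels G) (hne : ω' ≠ ω) (hne' : ω' ≠ ω⁻¹) (z : ℍ) :
    (A • z).im * (A' • z).im ≤ 1 / 2 := by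
  obtain ⟨M, hM⟩ : ∃ M, M = A * A'⁻¹ := ⟨_, rfl⟩
  have hMA (z : ℍ) : A • z = M • A' • z := by rw [hM, ← mul_smul, inv_mul_cancel_right]
  have mkpt (x y : ℝ) (hy : 0 < y) : ∃ z : ℍ, z.re = x ∧ z.im = y := ⟨⟨⟨x, y⟩, hy⟩, rfl, rfl⟩
  set r := M 1 0 with hr
  set s := M 1 1 with hs
  set c := (A' • I).re with hc
  -- the two sides at the cusp of `A'` are low in the chart `A`
  have hlow (x y : ℝ) (hx : |x - c| = 1 / 2) (hy : 0 < y) :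
      2 * y ≤ (r * x + s) ^ 2 + (r * y) ^ 2 := by
    obtain ⟨w, rfl, rfl⟩ := mkpt x y hy
    have hsmul : A' • A'⁻¹ • w = w := smul_inv_smul _ _
    have hmem (g : SL(2, ℝ)) (hg : g ∈ sideLabels G) (h : dist (A'⁻¹ • w) I =
        dist (A'⁻¹ • w) (g • I)) (h1 : g ≠ ω) (h2 : g ≠ ω⁻¹) :
        2 * w.im ≤ (r * w.re + s) ^ 2 + (r * w.im) ^ 2 := by
      have := hG.im_smul_le_half hA hω hg h1 h2 h
      rw [hMA, hsmul, im_smul_eq, div_le_iff₀ (smul_denom_pos M w)] at this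
      linarith
    obtain ⟨e₁, he₁, h₁, h₂⟩ := hA'.exists_shift
    have aux (e : ℝ) (h : w.re - c = e / 2) : dist w (A' • I) = dist w (e +ᵥ A' • I) := by
      rw [dist_eq_dist_iff', vadd_im, vadd_re, ← hc]
      congr 3
      linear_combination 2 * e * h
    have hcases : w.re - c = e₁ / 2 ∨ w.re - c = -e₁ / 2 := by
      rcases abs_cases (w.re - c) with ⟨h1, -⟩ | ⟨h1, -⟩ <;>
      rcases abs_cases e₁ with ⟨h2, -⟩ | ⟨h2, -⟩
      · left; linarith
      · right; linarith
      · right; linarith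
      · left; linarith
    rcases hcases with h | h
    · refine hmem ω' hω' ?_ hne hne'
      rw [← dist_smul A', ← dist_smul A' _ (ω' • I), hsmul, h₁]
      exact aux e₁ h
    · refine hmem ω'⁻¹ (inv_mem_sideLabels hω') ?_ (fun h => hne' (by rw [← h, inv_inv]))
        (fun h => hne (inv_injective h))
      rw [← dist_smul A', ← dist_smul A' _ (ω'⁻¹ • I), hsmul, h₂]
      exact aux (-e₁) h
  -- For r = 0 both charts would have the same point at infinity, and a vertical side in the chart
  -- of `A'` would be arbitrarily high in that of `A`.
  have hr0 : r ≠ 0 := by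
    intro h0
    have := hlow (c + 1 / 2) (s ^ 2 + 1) (by norm_num) (by positivity)
    rw [h0] at this
    nlinarith [sq_nonneg s]
  have hrpos : 0 < r ^ 2 := by positivity
  have hX (x : ℝ) (hx : |x - c| = 1 / 2) : 1 ≤ r ^ 2 * (r * x + s) ^ 2 := by
    have := hlow x (1 / r ^ 2) hx (by positivity)
    have h2 : (r * (1 / r ^ 2)) ^ 2 = 1 / r ^ 2 := by field_simp
    rw [h2] at this
    have h3 : 1 / r ^ 2 ≤ (r * x + s) ^ 2 := by linarith
    rwa [div_le_iff₀' hrpos] at h3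
  -- the cusp of `A` lies in the strip of the chart `A'`
  have hm : |r * c + s| ≤ |r| / 2 := by
    by_contra! hlt
    obtain ⟨P, hP⟩ : ∃ P, P = M 0 0 - r * ((A • I).re + 1 / 2) := ⟨_, rfl⟩
    set δ := |r * c + s| - |r| / 2 with hδ
    have hδpos : 0 < δ := by linarith
    have hdet : M 0 0 * M 1 1 - M 0 1 * M 1 0 = 1 := by
      have := M.det_coe
      rwa [Matrix.det_fin_two] at this
    have key (y : ℝ) (hy : 0 < y) : δ * (P ^ 2 + (r * y) ^ 2) ≤ |P| := by
      obtain ⟨w, hw, rfl⟩ := mkpt ((A • I).re + 1 / 2) y hy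
      have hF : A⁻¹ • w ∈ dirichletDomain G := by
        refine hG.mem_dirichletDomain_of_abs_re hA hω ?_
        rw [smul_inv_smul, hw]
        norm_num
      have hstrip := abs_re_sub_le_half hA' hω'.1 hF
      have hMinv : A' • A⁻¹ • w = M⁻¹ • w := by rw [hM, mul_inv_rev, inv_inv, mul_smul]
      have hentries : (M⁻¹) 0 0 = s ∧ (M⁻¹) 0 1 = -M 0 1 ∧ (M⁻¹) 1 0 = -r ∧
          (M⁻¹) 1 1 = M 0 0 := by
        simp [Matrix.SpecialLinearGroup.coe_inv, Matrix.adjugate_fin_two, hr, hs]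
      have hden := smul_denom_pos M⁻¹ w
      rw [hMinv, ← hc] at hstrip
      obtain ⟨e00, e01, e10, e11⟩ := hentries
      have hre : r * (M⁻¹ • w).re + s = P / (P ^ 2 + (r * w.im) ^ 2) := by
        have hden' : 0 < P ^ 2 + (r * w.im) ^ 2 := by
          rw [e10, e11, hw] at hden
          rw [hP]
          convert hden using 1
          ring
        have hdd : (-r * w.re + M 0 0) ^ 2 + (-r * w.im) ^ 2 = P ^ 2 + (r * w.im) ^ 2 := by
          rw [hP, hw]; ring
        rw [re_smul_eq, e00, e01, e10, e11, hdd, mul_div_assoc', div_add' _ _ _ hden'.ne',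
          div_left_inj' hden'.ne', hP, ← hw]
        linear_combination (M 0 0 - r * w.re) * hdet
      have hden' : 0 < P ^ 2 + (r * w.im) ^ 2 := by
        have := w.im_pos
        positivity
      have h1 : |r * c + s| ≤ |r| / 2 + |P| / (P ^ 2 + (r * w.im) ^ 2) := by
        have e : r * c + s = P / (P ^ 2 + (r * w.im) ^ 2) - r * ((M⁻¹ • w).re - c) := by
          rw [← hre]; ring
        rw [e]
        refine (abs_sub _ _).trans ?_
        rw [abs_mul, abs_div, abs_of_pos hden']
        nlinarith [abs_nonneg r]
      have h2 : δ ≤ |P| / (P ^ 2 + (r * w.im) ^ 2) := by linarith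
      rwa [le_div_iff₀ hden'] at h2
    -- The line at the edge of the strip of `A` lies in F and runs up to the cusp of `A`; at this
    -- height δ (r y)² = |P| + 1, contradicting `key`.
    have hy : 0 < √((|P| + 1) / (δ * r ^ 2)) := Real.sqrt_pos.2 (by positivity)
    have := key _ hy
    rw [mul_pow, Real.sq_sqrt (by positivity)] at this
    have h3 : δ * (r ^ 2 * ((|P| + 1) / (δ * r ^ 2))) = |P| + 1 := by field_simp
    nlinarith [mul_nonneg hδpos.le (sq_nonneg P)]
  -- In the chart of `A'` the cusp -s / r of `A` lies between the lines x = c ± 1/2, at distance at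
  -- least 1 / r² from each. These distances add up to one, so their product is at most 1/4 and r⁴ ≥
  -- 4.
  have hr2 : 2 ≤ r ^ 2 := by
    have h1 := hX (c + 1 / 2) (by norm_num)
    have h2 := hX (c - 1 / 2) (by rw [sub_sub_cancel_left, abs_neg]; norm_num)
    have hm2 : (r * c + s) ^ 2 ≤ r ^ 2 / 4 := by
      have := sq_le_sq' (by linarith [abs_nonneg (r * c + s), abs_nonneg r]) hm
      rw [sq_abs, div_pow, sq_abs] at this
      linarith
    set m := r * c + s with hmdef
    have e1 : r * (c + 1 / 2) + s = m + r / 2 := by rw [hmdef]; ring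
    have e2 : r * (c - 1 / 2) + s = m - r / 2 := by rw [hmdef]; ring
    rw [e1] at h1
    rw [e2] at h2
    have hT : 0 ≤ r ^ 2 / 4 - m ^ 2 := by linarith
    have hprod : 1 ≤ (r ^ 2 * (r ^ 2 / 4 - m ^ 2)) ^ 2 := by
      have : (r ^ 2 * (r ^ 2 / 4 - m ^ 2)) ^ 2 =
        (r ^ 2 * (m + r / 2) ^ 2) * (r ^ 2 * (m - r / 2) ^ 2) := by ring
      rw [this]
      nlinarith
    have h5 : 1 ≤ r ^ 2 * (r ^ 2 / 4 - m ^ 2) := by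
      by_contra! hlt
      have := mul_nonneg hrpos.le hT
      nlinarith
    nlinarith [sq_nonneg m, mul_nonneg hrpos.le (sq_nonneg m)]
  rw [hMA, im_smul_eq, div_mul_eq_mul_div, div_le_iff₀ (smul_denom_pos M _)]
  nlinarith [sq_nonneg (r * (A' • z).re + s), sq_nonneg (A' • z).im]

end Cusp

/-- The time needed for a low excursion over a horizontal distance `a`. -/
theorem two_log_add_log_two_le_dist {z w : ℍ} {a : ℝ} (ha : 1 ≤ a) (hz : z.im ^ 2 ≤ 1 / 2)
    (hw : w.im ^ 2 ≤ 1 / 2) (hre : a ≤ |z.re - w.re|) :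
    2 * Real.log a + Real.log 2 ≤ dist z w := by
  have h1 := z.im_pos
  have h2 := w.im_pos
  have h3 : a ^ 2 ≤ (z.re - w.re) ^ 2 := by
    rw [← sq_abs (z.re - w.re)]
    exact pow_le_pow_left₀ (by linarith) hre 2
  -- The height bounds give 2 · Im z · Im w ≤ 1, which is the source of the extra log 2.
  have h4 : a ^ 2 + 1 ≤ Real.cosh (dist z w) := by
    rw [cosh_dist_eq, le_div_iff₀ (by positivity)]
    nlinarith [sq_nonneg (z.im - w.im)]
  have h5 : 2 * a ^ 2 ≤ Real.exp (dist z w) := by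
    have := Real.exp_le_one_iff.2 (neg_nonpos.2 (dist_nonneg (x := z) (y := w)))
    rw [Real.cosh_eq] at h4
    linarith
  have h6 : Real.log (2 * a ^ 2) ≤ dist z w := by
    rw [Real.log_le_iff_le_exp (by positivity)]
    exact h5
  rw [Real.log_mul two_ne_zero (by positivity), Real.log_pow] at h6
  push_cast at h6
  linarith


/-! ### The ray and the tiles it traverses. -/

variable {x : OnePoint ℝ}

/-- The point `e^t i`. -/
noncomputable def vert (t : ℝ) : ℍ := ⟨⟨0, Real.exp t⟩, Real.exp_pos t⟩

theorem vert_re (t : ℝ) : (vert t).re = 0 := rfl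

theorem vert_im (t : ℝ) : (vert t).im = Real.exp t := rfl

theorem vert_zero : vert 0 = I := UpperHalfPlane.ext_re_im (by simp [vert_re])
  (by simp [vert_im])

theorem exists_ray_eq_smul_vert (x : OnePoint ℝ) :
    ∃ R : SL(2, ℝ), R • I = I ∧ ∀ t, ray x t = R • vert t := by
  suffices h : ∃ R : SL(2, ℝ), ∀ t, ray x t = R • vert t by
    obtain ⟨R, hR⟩ := h
    refine ⟨R, ?_, hR⟩
    rw [← vert_zero, ← hR]
    induction x using OnePoint.rec with
    | infty => rfl
    | coe x =>
      have : x ^ 2 + 1 ≠ 0 := by positivity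
      apply UpperHalfPlane.ext_re_im
      · change x * (Real.exp 0 ^ 2 - 1) / (x ^ 2 + Real.exp 0 ^ 2) = 0
        simp
      · change Real.exp 0 * (1 + x ^ 2) / (x ^ 2 + Real.exp 0 ^ 2) = Real.exp 0
        rw [Real.exp_zero]
        field_simp
        ring
  induction x using OnePoint.rec with
  | infty => exact ⟨1, fun t => by rw [one_smul]; rfl⟩
  | coe x =>
    have hx : 0 < 1 + x ^ 2 := by positivity
    obtain ⟨n, hn, hn2⟩ : ∃ n : ℝ, n ≠ 0 ∧ n ^ 2 = 1 + x ^ 2 :=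
      ⟨√(1 + x ^ 2), (Real.sqrt_pos.2 hx).ne', Real.sq_sqrt hx.le⟩
    obtain ⟨R, h00, h01, h10, h11⟩ := exists_SL2_of_entries (a := x / n) (b := -1 / n)
      (c := 1 / n) (d := x / n) (by field_simp; linarith)
    refine ⟨R, fun t => ?_⟩
    have he := Real.exp_pos t
    have hd : x ^ 2 + Real.exp t ^ 2 ≠ 0 := by positivity
    have hden : (1 / n * 0 + x / n) ^ 2 + (1 / n * Real.exp t) ^ 2 =
        (x ^ 2 + Real.exp t ^ 2) / n ^ 2 := by
      field_simp
      ring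
    apply UpperHalfPlane.ext_re_im
    · rw [re_smul_eq, h00, h01, h10, h11, vert_re, vert_im, hden]
      change x * (Real.exp t ^ 2 - 1) / (x ^ 2 + Real.exp t ^ 2) = _
      field_simp
      ring
    · rw [im_smul_eq, h10, h11, vert_re, vert_im, hden]
      change Real.exp t * (1 + x ^ 2) / (x ^ 2 + Real.exp t ^ 2) = _
      rw [← hn2]
      field_simp

theorem dist_ray (x : OnePoint ℝ) (t s : ℝ) : dist (ray x t) (ray x s) = |t - s| := by
  obtain ⟨R, -, hR⟩ := exists_ray_eq_smul_vert x
  rw [hR, hR, dist_smul, UpperHalfPlane.dist_of_re_eq (by rw [vert_re, vert_re]), vert_im, vert_im,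
    Real.log_exp, Real.log_exp, Real.dist_eq]

theorem ray_zero (x : OnePoint ℝ) : ray x 0 = I := by
  obtain ⟨R, hRI, hR⟩ := exists_ray_eq_smul_vert x
  rw [hR, vert_zero, hRI]

theorem dist_ray_I (x : OnePoint ℝ) (t : ℝ) : dist (ray x t) I = |t| := by
  rw [← ray_zero x, dist_ray, sub_zero]

theorem continuous_ray (x : OnePoint ℝ) : Continuous (ray x) :=
  (Isometry.of_dist_eq fun t s => by rw [dist_ray, Real.dist_eq]).continuous

/-- After rotation to the vertical ray the two `aff` values differ by α e^{2t} + β, which is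
monotone in t, so a half-plane meets the ray in an interval. -/
theorem dist_ray_le_dist_ray {w w' : ℍ} {t₁ t t₂ : ℝ} (h₁ : t₁ ≤ t) (h₂ : t ≤ t₂)
    (ht₁ : dist (ray x t₁) w ≤ dist (ray x t₁) w') (ht₂ : dist (ray x t₂) w ≤ dist (ray x t₂) w') :
    dist (ray x t) w ≤ dist (ray x t) w' := by
  obtain ⟨R, -, hR⟩ := exists_ray_eq_smul_vert x
  have hd (t : ℝ) (w : ℍ) : dist (ray x t) w = dist (vert t) (R⁻¹ • w) := by
    rw [hR, ← dist_smul R _ (R⁻¹ • w), smul_inv_smul]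
  simp only [hd, dist_le_dist_iff] at *
  have haff (t : ℝ) (w : ℍ) : aff w (proj (vert t)) =
      Real.exp t ^ 2 * (1 / w.im) + (w.re ^ 2 + w.im ^ 2) / w.im := by
    simp only [aff, proj, vert_re, vert_im]
    ring
  simp only [haff] at *
  have e1 : Real.exp t₁ ^ 2 ≤ Real.exp t ^ 2 := by gcongr
  have e2 : Real.exp t ^ 2 ≤ Real.exp t₂ ^ 2 := by gcongr
  rcases le_total (1 / (R⁻¹ • w).im) (1 / (R⁻¹ • w').im) with h | h <;> nlinarith

theorem ray_mem_smul_of_between {g : SL(2, ℝ)} (hg : g ∈ G) {t₁ t t₂ : ℝ} (h₁ : t₁ ≤ t)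
    (h₂ : t ≤ t₂) (ht₁ : ray x t₁ ∈ g • dirichletDomain G)
    (ht₂ : ray x t₂ ∈ g • dirichletDomain G) : ray x t ∈ g • dirichletDomain G := by
  rw [mem_smul_dirichletDomain_iff hg] at *
  exact fun k hk => dist_ray_le_dist_ray h₁ h₂ (ht₁ k hk) (ht₂ k hk)

theorem isClosed_smul_dirichletDomain {g : SL(2, ℝ)} (hg : g ∈ G) :
    IsClosed (g • dirichletDomain G) := by
  have e : g • dirichletDomain G = ⋂ k ∈ G, {z | dist z (g • I) ≤ dist z (k • I)} := by
    ext z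
    rw [mem_smul_dirichletDomain_iff hg]
    simp
  rw [e]
  exact isClosed_biInter fun k _ => isClosed_le (by fun_prop) (by fun_prop)

/-- A ray towards a radial limit point leaves every tile. -/
theorem bddAbove_times (hx : x ∈ radialLimitSet G) {g : SL(2, ℝ)} (hg : g ∈ G) :
    BddAbove {t | 0 ≤ t ∧ ray x t ∈ g • dirichletDomain G} := by
  by_contra hcon
  rw [not_bddAbove_iff] at hcon
  obtain ⟨t₀, ⟨-, ht₀⟩, -⟩ := hcon 0
  have hall (t : ℝ) (ht : t₀ ≤ t) : ray x t ∈ g • dirichletDomain G := by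
    obtain ⟨t', ⟨-, ht'⟩, hlt⟩ := hcon t
    exact ray_mem_smul_of_between hg ht hlt.le ht₀ ht'
  obtain ⟨c, hc⟩ := hx
  obtain ⟨t, ⟨k, hk, hkc⟩, ht0, ht⟩ :=
    (hc.and_eventually ((eventually_ge_atTop t₀).and
      (eventually_gt_atTop (c + dist (g • I) I)))).exists
  have h1 := (mem_smul_dirichletDomain_iff hg _).1 (hall t ht0) k hk
  have h2 := dist_triangle (ray x t) (g • I) I
  rw [dist_ray_I] at h2
  linarith [le_abs_self t]

theorem exitTime_mem (hx : x ∈ radialLimitSet G) {g : SL(2, ℝ)} (hg : g ∈ G)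
    (hne : ∃ t, 0 ≤ t ∧ ray x t ∈ g • dirichletDomain G) :
    0 ≤ exitTime G x g ∧ ray x (exitTime G x g) ∈ g • dirichletDomain G := by
  have hcl : IsClosed {t | 0 ≤ t ∧ ray x t ∈ g • dirichletDomain G} :=
    isClosed_Ici.inter ((isClosed_smul_dirichletDomain hg).preimage (continuous_ray x))
  exact hcl.csSup_mem hne (bddAbove_times hx hg)

theorem le_exitTime (hx : x ∈ radialLimitSet G) {g : SL(2, ℝ)} (hg : g ∈ G) {t : ℝ} (ht : 0 ≤ t)
    (h : ray x t ∈ g • dirichletDomain G) : t ≤ exitTime G x g :=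
  le_csSup (bddAbove_times hx hg) ⟨ht, h⟩

/-- The ray passes from each tile to the neighbour given by the exit label. -/
theorem HasTreeSides.exit_step (hG : HasTreeSides G) (hx : x ∈ radialLimitSet G) {g : SL(2, ℝ)}
    (hg : g ∈ G) (hne : ∃ t, 0 ≤ t ∧ ray x t ∈ g • dirichletDomain G) :
    exitLabel G x g ∈ sideLabels G ∧
      ray x (exitTime G x g) ∈ (g * exitLabel G x g) • dirichletDomain G ∧
      exitTime G x g < exitTime G x (g * exitLabel G x g) := by
  have := hG.discrete
  obtain ⟨hT0, hTg⟩ := exitTime_mem hx hg hne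
  set T := exitTime G x g with hT
  have hev : ∀ᶠ t in 𝓝[>] T, ∀ k ∈ G, proj (ray x t) ∈ cell G k → proj (ray x T) ∈ cell G k :=
    ((((continuous_proj.comp (continuous_ray x)).tendsto T).eventually
      (eventually_mem_cell (G := G) (proj_mem_para _))).mono fun t h => h.2).filter_mono
        nhdsWithin_le_nhds
  obtain ⟨t, ht, hTt⟩ := (hev.and eventually_mem_nhdsWithin).exists
  replace hTt : T < t := hTt
  obtain ⟨k, hk, htk⟩ := exists_mem_cell (G := G) (proj_mem_para (ray x t))
  have hTk := ht k hk htk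
  have hgk : g ≠ k := by
    rintro rfl
    rw [proj_mem_cell_iff hk] at htk
    exact absurd (le_exitTime hx hk (hT0.trans hTt.le) htk) (not_le.2 hTt)
  have hTg' := (proj_mem_cell_iff hg _).2 hTg
  have hex : ∃ ω ∈ sideLabels G,
      ray x T ∈ g • (dirichletDomain G ∩ ω • dirichletDomain G) := by
    refine ⟨g⁻¹ * k, hG.mem_sideLabels hg hk hgk hTg' hTk, ?_⟩
    rw [Set.smul_set_inter, smul_smul, mul_inv_cancel_left]
    exact ⟨hTg, (proj_mem_cell_iff hk _).1 hTk⟩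
  have hlabel : exitLabel G x g ∈ sideLabels G ∧
      ray x T ∈ g • (dirichletDomain G ∩ exitLabel G x g • dirichletDomain G) := by
    rw [exitLabel, dif_pos hex]
    exact hex.choose_spec
  generalize exitLabel G x g = ω at hlabel ⊢
  obtain ⟨hω, hmem⟩ := hlabel
  rw [Set.smul_set_inter, smul_smul] at hmem
  have hgω : g * ω ∈ G := mul_mem hg hω.1
  -- Only the tiles g and k contain the exit point, so the label is determined although it is picked
  -- by choice.
  have hgωk : g * ω = k := by
    refine (hG.eq_or_eq hg hk hgω hgk hTg' hTk ((proj_mem_cell_iff hgω _).2 hmem.2)).resolve_left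
      fun h => hω.2.1 (by simpa using h)
  refine ⟨hω, hmem.2, hTt.trans_le ?_⟩
  rw [hgωk]
  exact le_exitTime hx hk (hT0.trans hTt.le) ((proj_mem_cell_iff hk _).1 htk)

/-- The time at which the ray enters its `n`-th tile. -/
noncomputable def entryTime (G : Subgroup SL(2, ℝ)) (x : OnePoint ℝ) : ℕ → ℝ
  | 0 => 0
  | n + 1 => exitTime G x (tile G x n)

theorem tile_succ (n : ℕ) : tile G x (n + 1) = tile G x n * letter G x n := rfl

section Tiles

variable (hG : HasTreeSides G) (hx : x ∈ radialLimitSet G)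

include hG hx

theorem HasTreeSides.tile_mem_and (n : ℕ) : tile G x n ∈ G ∧ 0 ≤ entryTime G x n ∧
    ray x (entryTime G x n) ∈ tile G x n • dirichletDomain G := by
  induction n with
  | zero =>
    refine ⟨G.one_mem, le_rfl, ?_⟩
    change ray x 0 ∈ (1 : SL(2, ℝ)) • dirichletDomain G
    rw [one_smul, ray_zero]
    intro g _
    rw [dist_self]
    exact dist_nonneg
  | succ n ih =>
    obtain ⟨h1, h2, h3⟩ := ih
    obtain ⟨h4, h5, -⟩ := hG.exit_step hx h1 ⟨_, h2, h3⟩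
    exact ⟨mul_mem h1 h4.1, (exitTime_mem hx h1 ⟨_, h2, h3⟩).1, h5⟩

theorem HasTreeSides.tile_mem (n : ℕ) : tile G x n ∈ G := (hG.tile_mem_and hx n).1

theorem HasTreeSides.letter_mem (n : ℕ) : letter G x n ∈ sideLabels G :=
  (hG.exit_step hx (hG.tile_mem hx n) ⟨_, (hG.tile_mem_and hx n).2⟩).1

theorem HasTreeSides.entryTime_monotone : Monotone (entryTime G x) :=
  monotone_nat_of_le_succ fun n => le_exitTime hx (hG.tile_mem hx n) (hG.tile_mem_and hx n).2.1
    (hG.tile_mem_and hx n).2.2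

theorem HasTreeSides.exitTime_strictMono : StrictMono fun n => exitTime G x (tile G x n) :=
  strictMono_nat_of_lt_succ fun n =>
    (hG.exit_step hx (hG.tile_mem hx n) ⟨_, (hG.tile_mem_and hx n).2⟩).2.2

theorem HasTreeSides.ray_entryTime_succ_mem (n : ℕ) :
    ray x (entryTime G x (n + 1)) ∈ tile G x n • dirichletDomain G :=
  (exitTime_mem hx (hG.tile_mem hx n) ⟨_, (hG.tile_mem_and hx n).2⟩).2

theorem HasTreeSides.ray_mem_tile {n : ℕ} {t : ℝ} (h1 : entryTime G x n ≤ t)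
    (h2 : t ≤ entryTime G x (n + 1)) : ray x t ∈ tile G x n • dirichletDomain G :=
  ray_mem_smul_of_between (hG.tile_mem hx n) h1 h2 (hG.tile_mem_and hx n).2.2
    (hG.ray_entryTime_succ_mem hx n)

theorem HasTreeSides.tile_injective : Function.Injective (tile G x) := by
  intro m n h
  exact (hG.exitTime_strictMono hx).injective (by simp only [h])

theorem HasTreeSides.letter_succ_ne_inv (n : ℕ) : letter G x (n + 1) ≠ (letter G x n)⁻¹ := by
  intro h
  have : tile G x (n + 2) = tile G x n := by
    rw [tile_succ, tile_succ, h, mul_inv_cancel_right]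
  have := hG.tile_injective hx this
  omega

/-- Bounded entry times would make infinitely many distinct tiles accumulate at one point of the
ray. -/
theorem HasTreeSides.tendsto_entryTime : Tendsto (entryTime G x) atTop atTop := by
  have := hG.discrete
  refine tendsto_atTop_atTop_of_monotone (hG.entryTime_monotone hx) ?_
  by_contra! hcon
  obtain ⟨B, hB⟩ := hcon
  have hbdd : BddAbove (Set.range (entryTime G x)) := ⟨B, by rintro _ ⟨n, rfl⟩; exact (hB n).le⟩
  have hlim := tendsto_atTop_ciSup (hG.entryTime_monotone hx) hbdd
  obtain ⟨N, hN⟩ := eventually_atTop.1 ((((continuous_proj.comp (continuous_ray x)).tendsto _).comp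
    hlim).eventually (eventually_mem_cell (G := G) (proj_mem_para _)))
  refine Set.infinite_of_injective_forall_mem (f := fun n => tile G x (N + n))
    (fun m n h => by simpa using hG.tile_injective hx h) (fun n => ?_)
    (finite_cells (G := G) (proj_mem_para (ray x (⨆ n, entryTime G x n))))
  refine ⟨hG.tile_mem hx _, (hN (N + n) (by omega)).2 _ (hG.tile_mem hx _) ?_⟩
  exact (proj_mem_cell_iff (hG.tile_mem hx _) _).2 (hG.tile_mem_and hx _).2.2

theorem HasTreeSides.exists_between_entryTime {t : ℝ} (ht : 0 ≤ t) :
    ∃ n, entryTime G x n ≤ t ∧ t < entryTime G x (n + 1) := by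
  classical
  have hex : ∃ n, t < entryTime G x n := ((hG.tendsto_entryTime hx).eventually_gt_atTop t).exists
  have hspec := Nat.find_spec hex
  obtain ⟨n, hn⟩ : ∃ n, Nat.find hex = n + 1 := by
    refine Nat.exists_eq_succ_of_ne_zero fun h0 => ?_
    rw [h0] at hspec
    exact absurd ht (not_le.2 hspec)
  refine ⟨n, not_lt.1 (Nat.find_min hex (by omega)), ?_⟩
  rwa [hn] at hspec

theorem HasTreeSides.smul_ray_mem {n : ℕ} {t : ℝ} (h1 : entryTime G x n ≤ t)
    (h2 : t ≤ entryTime G x (n + 1)) : (tile G x n)⁻¹ • ray x t ∈ dirichletDomain G :=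
  Set.mem_smul_set_iff_inv_smul_mem.1 (hG.ray_mem_tile hx h1 h2)

theorem HasTreeSides.dist_exit_eq (n : ℕ) :
    dist ((tile G x n)⁻¹ • ray x (entryTime G x (n + 1))) I =
      dist ((tile G x n)⁻¹ • ray x (entryTime G x (n + 1))) (letter G x n • I) := by
  refine dist_eq_of_mem_inter (hG.letter_mem hx n).1 ⟨hG.smul_ray_mem hx
    (hG.entryTime_monotone hx n.le_succ) le_rfl, ?_⟩
  have := (hG.tile_mem_and hx (n + 1)).2.2
  rw [tile_succ, mul_smul] at this
  exact Set.mem_smul_set_iff_inv_smul_mem.1 this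

theorem HasTreeSides.dist_entry_eq (n : ℕ) :
    dist ((tile G x (n + 1))⁻¹ • ray x (entryTime G x (n + 1))) I =
      dist ((tile G x (n + 1))⁻¹ • ray x (entryTime G x (n + 1))) ((letter G x n)⁻¹ • I) := by
  have h := hG.dist_exit_eq hx n
  rw [tile_succ, mul_inv_rev, mul_smul, dist_smul, h, ← dist_smul (letter G x n)⁻¹ _ (_ • I),
    inv_smul_smul]

end Tiles

/-- Along a ray the height over a cusp tends to zero or to infinity. -/
theorem eventually_im_smul_ray_lt_or (x : OnePoint ℝ) (B : SL(2, ℝ)) {a : ℝ} (ha : 0 < a) (b : ℝ) :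
    ∀ᶠ t in atTop, (B • ray x t).im < a ∨ b < (B • ray x t).im := by
  obtain ⟨R, -, hR⟩ := exists_ray_eq_smul_vert x
  have him (t : ℝ) : (B • ray x t).im =
      Real.exp t / ((B * R) 1 1 ^ 2 + ((B * R) 1 0 * Real.exp t) ^ 2) := by
    rw [hR, ← mul_smul, im_smul_eq, vert_re, vert_im, mul_zero, zero_add]
  have hpos (t : ℝ) : 0 < (B * R) 1 1 ^ 2 + ((B * R) 1 0 * Real.exp t) ^ 2 := by
    have := smul_denom_pos (B * R) (vert t)
    rwa [vert_re, vert_im, mul_zero, zero_add] at this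
  simp only [him]
  generalize (B * R) 1 1 = d at *
  generalize (B * R) 1 0 = c at *
  by_cases hc : c = 0
  · subst hc
    filter_upwards [Real.tendsto_exp_atTop.eventually_gt_atTop (b * d ^ 2)] with t ht
    right
    rw [lt_div_iff₀ (hpos t)]
    simpa using ht
  · have hc2 : 0 < c ^ 2 := by positivity
    filter_upwards [Real.tendsto_exp_atTop.eventually_gt_atTop (1 / (a * c ^ 2))] with t ht
    left
    rw [div_lt_iff₀ (hpos t)]
    rw [div_lt_iff₀ (by positivity)] at ht
    nlinarith [Real.exp_pos t, mul_nonneg ha.le (sq_nonneg d)]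


/-! ### Combinatorics of the block decomposition. -/

section Blocks

variable {P : Set SL(2, ℝ)} {ω : ℕ → SL(2, ℝ)}
  (hrun : ∀ m, ω m ∈ P → ∃ m', m < m' ∧ ω m' ≠ ω m)

include hrun

theorem blockStart_succ_mem (k : ℕ) : blockStart P ω k < blockStart P ω (k + 1) ∧
    ¬ (ω (blockStart P ω k) ∈ P ∧ ω (blockStart P ω (k + 1)) = ω (blockStart P ω k)) := by
  have hne : {m | blockStart P ω k < m ∧
      ¬ (ω (blockStart P ω k) ∈ P ∧ ω m = ω (blockStart P ω k))}.Nonempty := by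
    by_cases h : ω (blockStart P ω k) ∈ P
    · obtain ⟨m', h1, h2⟩ := hrun _ h
      exact ⟨m', h1, fun h' => h2 h'.2⟩
    · exact ⟨_, Nat.lt_succ_self _, fun h' => h h'.1⟩
  exact Nat.sInf_mem hne

theorem blockStart_strictMono : StrictMono (blockStart P ω) :=
  strictMono_nat_of_lt_succ fun k => (blockStart_succ_mem hrun k).1

theorem exists_blockStart_le (j : ℕ) :
    ∃ n, blockStart P ω n ≤ j ∧ j < blockStart P ω (n + 1) := by
  induction j with
  | zero => exact ⟨0, le_rfl, (blockStart_succ_mem hrun 0).1⟩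
  | succ j ih =>
    obtain ⟨n, h1, h2⟩ := ih
    rcases (Nat.succ_le_of_lt h2).eq_or_lt with h | h
    · exact ⟨n + 1, h.symm.le, h.trans_lt (blockStart_succ_mem hrun (n + 1)).1⟩
    · exact ⟨n, h1.trans j.le_succ, h⟩

omit hrun in
theorem letter_eq_of_mem_block {k m : ℕ} (h1 : blockStart P ω k < m)
    (h2 : m < blockStart P ω (k + 1)) :
    ω (blockStart P ω k) ∈ P ∧ ω m = ω (blockStart P ω k) := by
  by_contra hcon
  exact Nat.notMem_of_lt_sInf h2 ⟨h1, hcon⟩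

omit hrun in
theorem letter_eq_of_mem_block' {k m : ℕ} (h1 : blockStart P ω k ≤ m)
    (h2 : m < blockStart P ω (k + 1)) : ω m = ω (blockStart P ω k) := by
  rcases h1.eq_or_lt with rfl | h1
  · rfl
  · exact (letter_eq_of_mem_block h1 h2).2

end Blocks

theorem tile_add_eq_of_run {m i : ℕ} {s : SL(2, ℝ)}
    (h : ∀ j, m ≤ j → j < m + i → letter G x j = s) : tile G x (m + i) = tile G x m * s ^ i := by
  induction i with
  | zero => simp
  | succ i ih =>
    rw [← add_assoc, tile_succ, ih fun j h1 h2 => h j h1 (by omega),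
      h (m + i) (by omega) (by omega), pow_succ, mul_assoc]

theorem dist_tile_add_le {D : ℝ} (hD : ∀ j, dist (letter G x j • I) I ≤ D) (m i : ℕ) :
    dist (tile G x (m + i) • I) (tile G x m • I) ≤ i * D := by
  induction i with
  | zero => simp
  | succ i ih =>
    have h1 := dist_triangle (tile G x (m + (i + 1)) • I) (tile G x (m + i) • I) (tile G x m • I)
    have h2 : dist (tile G x (m + (i + 1)) • I) (tile G x (m + i) • I) ≤ D := by
      rw [← add_assoc, tile_succ, mul_smul, dist_smul]
      exact hD _
    push_cast
    linarith

/-! ### Cusp excursions of the ray. -/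

section Cusps

variable {P : Set SL(2, ℝ)} {A : SL(2, ℝ) → SL(2, ℝ)}

/-- The word of a radial limit point has no infinite run of a parabolic letter. -/
theorem HasTreeSides.exists_letter_ne (hG : HasTreeSides G) (hx : x ∈ radialLimitSet G)
    {B : SL(2, ℝ)} (m : ℕ) (hB : IsCuspChart B (letter G x m)) :
    ∃ m', m < m' ∧ letter G x m' ≠ letter G x m := by
  by_contra! hcon
  obtain ⟨e, -, he⟩ := hB
  have htile (i : ℕ) : tile G x (m + i) = tile G x m * letter G x m ^ i :=
    tile_add_eq_of_run fun j h1 _ => h1.eq_or_lt.elim (fun h => h ▸ rfl) (hcon j)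
  obtain ⟨c, hc⟩ := id hx
  obtain ⟨t, ⟨⟨k, hk, hkc⟩, hesc⟩, ht, ht0⟩ := ((hc.and_eventually
    (eventually_im_smul_ray_lt_or x (B * (tile G x m)⁻¹)
      (a := (B • I).im / Real.exp c) (div_pos (B • I).im_pos (Real.exp_pos c))
      ((B • I).im * Real.exp c))).and_eventually ((eventually_ge_atTop (entryTime G x m)).and
        (eventually_ge_atTop 0))).exists
  obtain ⟨j, hj1, hj2⟩ := hG.exists_between_entryTime hx ht0
  have hmj : m ≤ j := by
    by_contra! hlt
    exact absurd (ht.trans_lt hj2) (not_lt.2 (hG.entryTime_monotone hx hlt))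
  obtain ⟨i, rfl⟩ := Nat.exists_eq_add_of_le hmj
  have hd : dist ((tile G x (m + i))⁻¹ • ray x t) I ≤ c := by
    refine le_trans ?_ hkc
    have h1 := (mem_smul_dirichletDomain_iff (hG.tile_mem hx (m + i)) _).1
      (hG.ray_mem_tile hx hj1 hj2.le) k hk
    rwa [← dist_smul (tile G x (m + i)) (_ • _) I, smul_inv_smul]
  rw [← dist_smul B] at hd
  -- Within the run the tiles differ by powers of the parabolic letter, so the height over its cusp
  -- may be measured from any of them. A return to the orbit keeps this height near that of i,
  -- whereas along the ray it tends to zero or infinity.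
  have him : (B • (tile G x (m + i))⁻¹ • ray x t).im = ((B * (tile G x m)⁻¹) • ray x t).im := by
    have h1 := vadd_smul_pow he i ((tile G x (m + i))⁻¹ • ray x t)
    have h2 : letter G x m ^ i • (tile G x (m + i))⁻¹ • ray x t =
        (tile G x m)⁻¹ • ray x t := by
      rw [htile, mul_inv_rev, mul_smul, smul_inv_smul]
    rw [h2] at h1
    rw [mul_smul, h1, vadd_im]
  rw [← him] at hesc
  have hexp : Real.exp (dist (B • (tile G x (m + i))⁻¹ • ray x t) (B • I)) ≤ Real.exp c :=
    Real.exp_le_exp.2 hd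
  have hI := (B • I).im_pos
  rcases hesc with h | h
  · have h1 := im_le_im_mul_exp_dist (B • I) (B • (tile G x (m + i))⁻¹ • ray x t)
    rw [dist_comm] at h1
    rw [lt_div_iff₀ (Real.exp_pos c)] at h
    have := mul_le_mul_of_nonneg_left hexp (B • (tile G x (m + i))⁻¹ • ray x t).im_pos.le
    linarith
  · have h1 := im_le_im_mul_exp_dist (B • (tile G x (m + i))⁻¹ • ray x t) (B • I)
    have := mul_le_mul_of_nonneg_left hexp hI.le
    linarith

/-- Inside a tile, the ray passes a point which is low over both the cusp of the letter before and the
cusp of the letter behind that tile. -/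
theorem HasTreeSides.exists_low_time (hG : HasTreeSides G) (hx : x ∈ radialLimitSet G)
    (hA : ∀ s ∈ P, IsCuspChart (A s) s) (m : ℕ)
    (hne : letter G x m ∈ P → letter G x (m + 1) ≠ letter G x m) :
    ∃ t, entryTime G x (m + 1) ≤ t ∧ t ≤ entryTime G x (m + 2) ∧
      (letter G x m ∈ P → (A (letter G x m) • (tile G x (m + 1))⁻¹ • ray x t).im ^ 2 ≤ 1 / 2) ∧
      (letter G x (m + 1) ∈ P →
        (A (letter G x (m + 1)) • (tile G x (m + 1))⁻¹ • ray x t).im ^ 2 ≤ 1 / 2) := by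
  have hmono : entryTime G x (m + 1) ≤ entryTime G x (m + 2) := hG.entryTime_monotone hx (by omega)
  have ha := hG.letter_mem hx m
  have hb := hG.letter_mem hx (m + 1)
  have hinv := hG.letter_succ_ne_inv hx m
  have hentry := hG.dist_entry_eq hx m
  have hexit := hG.dist_exit_eq hx (m + 1)
  have hsq {y : ℍ} (hy : y.im ≤ 1 / 2) : y.im ^ 2 ≤ 1 / 2 := by nlinarith [y.im_pos]
  by_cases haP : letter G x m ∈ P
  · have hne := hne haP
    have hlow := hG.im_smul_le_half (hA _ haP) ha hb hne hinv hexit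
    by_cases hbP : letter G x (m + 1) ∈ P
    · have hlow' := hG.im_smul_le_half (hA _ hbP) hb (inv_mem_sideLabels ha)
        (fun h => hinv h.symm) (fun h => hne (inv_injective h).symm) hentry
      have hprod (t : ℝ) := hG.im_smul_mul_im_smul_le (hA _ haP) ha (hA _ hbP) hb hne hinv
        ((tile G x (m + 1))⁻¹ • ray x t)
      have hcont : Continuous fun t =>
          (A (letter G x m) • (tile G x (m + 1))⁻¹ • ray x t).im := by
        have := continuous_ray x
        exact UpperHalfPlane.continuous_im.comp ((this.const_smul _).const_smul _)
      by_cases hfirst : (A (letter G x m) • (tile G x (m + 1))⁻¹ •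
          ray x (entryTime G x (m + 1))).im ≤ √(1 / 2)
      · refine ⟨_, le_rfl, hmono, fun _ => ?_, fun _ => hsq hlow'⟩
        have h1 := pow_le_pow_left₀ (UpperHalfPlane.im_pos _).le hfirst 2
        rwa [Real.sq_sqrt (by norm_num)] at h1
      · have hlast : (A (letter G x m) • (tile G x (m + 1))⁻¹ •
            ray x (entryTime G x (m + 2))).im ≤ √(1 / 2) :=
          hlow.trans (Real.le_sqrt_of_sq_le (by norm_num))
        -- Where the height over the first cusp is √(1/2), the product bound makes the other at most
        -- √(1/2).
        obtain ⟨t, ht, hte⟩ := intermediate_value_Icc' hmono hcont.continuousOn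
          ⟨hlast, (not_le.1 hfirst).le⟩
        simp only at hte
        have hpos : 0 < √(1 / 2 : ℝ) := Real.sqrt_pos.2 (by norm_num)
        have hs : √(1 / 2 : ℝ) ^ 2 = 1 / 2 := Real.sq_sqrt (by norm_num)
        refine ⟨t, ht.1, ht.2, fun _ => by rw [hte, hs], fun _ => ?_⟩
        have h1 := hprod t
        rw [hte] at h1
        have h2 := (A (letter G x (m + 1)) • (tile G x (m + 1))⁻¹ • ray x t).im_pos
        have h3 : (A (letter G x (m + 1)) • (tile G x (m + 1))⁻¹ • ray x t).im ≤ √(1 / 2) := by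
          refine le_of_mul_le_mul_left (h1.trans_eq ?_) hpos
          rw [← sq, hs]
        rw [← hs]
        exact pow_le_pow_left₀ h2.le h3 2
    · exact ⟨_, hmono, le_rfl, fun _ => hsq hlow, fun h => absurd h hbP⟩
  · refine ⟨_, le_rfl, hmono, fun h => absurd h haP, fun hbP => hsq ?_⟩
    exact hG.im_smul_le_half (hA _ hbP) hb (inv_mem_sideLabels ha)
        (fun h => hinv h.symm) (fun h => haP (by rwa [inv_injective h])) hentry

/-- The time needed to pass a run of `n` equal parabolic letters between two low points. -/
theorem run_time_le (hG : HasTreeSides G) (hx : x ∈ radialLimitSet G) {s B : SL(2, ℝ)}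
    (hB : IsCuspChart B s) (hs : s ∈ sideLabels G) {m n : ℕ} (hn : 2 ≤ n)
    (hrun : ∀ j, m ≤ j → j < m + n → letter G x j = s) {t t' : ℝ}
    (ht : entryTime G x m ≤ t ∧ t ≤ entryTime G x (m + 1))
    (ht' : entryTime G x (m + n) ≤ t' ∧ t' ≤ entryTime G x (m + n + 1))
    (hlow : (B • (tile G x m)⁻¹ • ray x t).im ^ 2 ≤ 1 / 2)
    (hlow' : (B • (tile G x (m + n))⁻¹ • ray x t').im ^ 2 ≤ 1 / 2) :
    2 * Real.log (n - 1 : ℕ) + Real.log 2 ≤ t' - t := by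
  have htile := tile_add_eq_of_run hrun
  have hle : t ≤ t' := ht.2.trans ((hG.entryTime_monotone hx (by omega)).trans ht'.1)
  have hz := hG.smul_ray_mem hx ht.1 ht.2
  have hz' := hG.smul_ray_mem hx ht'.1 ht'.2
  have h1 := abs_re_sub_le_half hB hs.1 hz
  have h2 := abs_re_sub_le_half hB hs.1 hz'
  obtain ⟨e, he, h⟩ := hB
  have h3 := vadd_smul_pow h n ((tile G x (m + n))⁻¹ • ray x t')
  have h4 : s ^ n • (tile G x (m + n))⁻¹ • ray x t' = (tile G x m)⁻¹ • ray x t' := by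
    rw [htile, mul_inv_rev, mul_smul, smul_inv_smul]
  rw [h4] at h3
  have hn1 : ((n - 1 : ℕ) : ℝ) = n - 1 := by
    rw [Nat.cast_sub (by omega), Nat.cast_one]
  -- The two tiles lie in strips of width one whose centres are n apart, so the horizontal distance
  -- is at least n - 1.
  have h5 := two_log_add_log_two_le_dist (a := (n - 1 : ℕ))
    (z := B • (tile G x m)⁻¹ • ray x t) (w := B • (tile G x m)⁻¹ • ray x t')
    (by rw [hn1]; have : (2 : ℝ) ≤ n := by exact_mod_cast hn
        linarith) hlow (by rw [h3, vadd_im]; exact hlow') (by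
      rw [h3, vadd_re, hn1]
      have h6 : |n * e| = n := by rw [abs_mul, he, mul_one, Nat.abs_cast]
      rw [abs_le] at h1 h2
      rcases abs_cases ((n : ℝ) * e) with ⟨h7, -⟩ | ⟨h7, -⟩
      · rw [le_abs]; right; linarith
      · rw [le_abs]; left; linarith)
  rwa [dist_smul, dist_smul, dist_ray, abs_sub_comm, abs_of_nonneg (sub_nonneg.2 hle)] at h5

end Cusps

/-! ### Consequences of bounded winding numbers. -/

theorem finite_symmSet {ι : Type} [Finite ι] (f : ι → SL(2, ℝ)) : (symmSet f).Finite :=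
  (Set.finite_range _).union (Set.finite_range _)

theorem IsFreeFuchsian.exists_isCuspChart (hG : IsFreeFuchsian G h γ) {s : SL(2, ℝ)}
    (hs : s ∈ symmSet γ) : ∃ A, IsCuspChart A s := by
  rcases hs with ⟨j, rfl⟩ | ⟨j, rfl⟩
  · exact CuspWinding.exists_isCuspChart (hG.parabolic j)
  · obtain ⟨A, hA⟩ := CuspWinding.exists_isCuspChart (hG.parabolic j)
    exact ⟨A, hA.inv⟩

theorem IsFreeFuchsian.exists_letter_ne (hG : IsFreeFuchsian G h γ) (hx : x ∈ radialLimitSet G)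
    (m : ℕ) (hm : letter G x m ∈ symmSet γ) : ∃ m', m < m' ∧ letter G x m' ≠ letter G x m := by
  obtain ⟨B, hB⟩ := hG.exists_isCuspChart hm
  exact hG.hasTreeSides.exists_letter_ne hx m hB

/-- There are times in the first tile of each block, the differences of which are bounded below in
terms of the cusp-winding numbers. -/
theorem IsFreeFuchsian.exists_block_times (hG : IsFreeFuchsian G h γ)
    (hx : x ∈ radialLimitSet G) : ∃ σ : ℕ → ℝ,
      (∀ k, σ k ≤ entryTime G x (blockStart (symmSet γ) (letter G x) (k + 2))) ∧
      (∀ k, 0 ≤ σ k) ∧ (∀ k, σ k ≤ σ (k + 1)) ∧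
      ∀ k, 1 ≤ cuspWinding G γ x (k + 1) →
        2 * Real.log (cuspWinding G γ x (k + 1)) + Real.log 2 ≤ σ (k + 1) - σ k := by
  have hT := hG.hasTreeSides
  have hrun := hG.exists_letter_ne hx
  choose! A hA using fun s (hs : s ∈ symmSet γ) => hG.exists_isCuspChart hs
  set P := symmSet γ with hP
  set b := blockStart P (letter G x) with hb
  have hbm : StrictMono b := blockStart_strictMono hrun
  have hmono := hT.entryTime_monotone hx
  -- The times begin with block k + 1, since block 0 has no preceding letter.
  have hstart (k : ℕ) : ∃ t, entryTime G x (b (k + 1)) ≤ t ∧ t ≤ entryTime G x (b (k + 1) + 1) ∧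
      (letter G x (b k) ∈ P →
        (A (letter G x (b k)) • (tile G x (b (k + 1)))⁻¹ • ray x t).im ^ 2 ≤ 1 / 2) ∧
      (letter G x (b (k + 1)) ∈ P →
        (A (letter G x (b (k + 1))) • (tile G x (b (k + 1)))⁻¹ • ray x t).im ^ 2 ≤ 1 / 2) := by
    have hlt : b k < b (k + 1) := hbm k.lt_succ_self
    obtain ⟨m, hm⟩ : ∃ m, b (k + 1) = m + 1 := Nat.exists_eq_succ_of_ne_zero (by omega)
    have hlast : letter G x m = letter G x (b k) :=
      letter_eq_of_mem_block' (by change b k ≤ m; omega) (by change m < b (k + 1); omega)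
    have hmem := (blockStart_succ_mem hrun k).2
    rw [hm, ← hlast]
    refine hT.exists_low_time hx hA m fun hmP h' => hmem ⟨?_, ?_⟩
    · rwa [← hb, ← hlast]
    · rw [← hb, hm, ← hlast, h']
  choose σ h1 h2 h3 h4 using hstart
  have hle (k : ℕ) : σ k ≤ entryTime G x (b (k + 2)) := (h2 k).trans (hmono (hbm (by omega)))
  refine ⟨σ, hle, fun k => (hT.tile_mem_and hx _).2.1.trans (h1 k),
    fun k => (hle k).trans (h1 (k + 1)), fun k hk => ?_⟩
  have hlen : cuspWinding G γ x (k + 1) = b (k + 2) - b (k + 1) - 1 := rfl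
  rw [hlen] at hk ⊢
  have hP' : letter G x (b (k + 1)) ∈ P :=
    (letter_eq_of_mem_block (m := b (k + 1) + 1) (by change b (k + 1) < _; omega)
      (by change _ < b (k + 2); omega)).1
  obtain ⟨n, hn⟩ : ∃ n, b (k + 2) = b (k + 1) + n :=
    Nat.exists_eq_add_of_le (hbm (Nat.lt_succ_self _)).le
  rw [hn] at hk ⊢
  rw [Nat.add_sub_cancel_left] at hk ⊢
  have h1' := h1 (k + 1)
  have h2' := h2 (k + 1)
  have h3' := h3 (k + 1) hP'
  rw [show k + 1 + 1 = k + 2 from rfl, hn] at h1' h2' h3'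
  exact run_time_le hT hx (hA _ hP') (hT.letter_mem hx _) (by omega)
    (fun j hj hj' => letter_eq_of_mem_block' hj (hj'.trans_eq hn.symm))
    ⟨h1 k, h2 k⟩ ⟨h1', h2'⟩ (h4 k hP') h3'

theorem posLog_natCast_of_one_le {a : ℕ} (ha : 1 ≤ a) : Real.posLog a = Real.log a :=
  max_eq_right (Real.log_nonneg (by exact_mod_cast ha))

/-- With bounded cusp-winding numbers, their logarithmic sum falls short of the time by a factor. -/
theorem IsFreeFuchsian.exists_sum_posLog_le (hG : IsFreeFuchsian G h γ)
    (hx : x ∈ radialLimitSet G) {N : ℕ} (hN : ∀ n, cuspWinding G γ x n ≤ N) :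
    ∃ ε > 0, ∃ C, ∀ n, (1 + ε) * (2 * ∑ k ∈ Finset.range n, Real.posLog (cuspWinding G γ x k)) ≤
      entryTime G x (blockStart (symmSet γ) (letter G x) n) + C := by
  obtain ⟨σ, hσ, hσ0, hσm, hσd⟩ := hG.exists_block_times hx
  have hT := hG.hasTreeSides
  set L := Real.posLog N with hL
  have hL0 : 0 ≤ L := Real.posLog_nonneg
  have hlog2 : 0 < Real.log 2 := Real.log_pos one_lt_two
  -- With this ε one has ε · 2 log a ≤ log 2 for 1 ≤ a ≤ N; L + 1 keeps the denominator positive.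
  set ε := Real.log 2 / (2 * (L + 1)) with hε
  have hε0 : 0 < ε := by positivity
  have haL (k : ℕ) : Real.posLog (cuspWinding G γ x k) ≤ L :=
    Real.posLog_le_posLog (by positivity) (by exact_mod_cast hN k)
  have hstep (k : ℕ) : (1 + ε) * (2 * Real.posLog (cuspWinding G γ x (k + 1))) ≤
      σ (k + 1) - σ k := by
    rcases Nat.eq_zero_or_pos (cuspWinding G γ x (k + 1)) with h0 | hpos
    · rw [h0]
      simpa using hσm k
    · refine le_trans ?_ (hσd k hpos)
      rw [← posLog_natCast_of_one_le hpos]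
      have : ε * (2 * (L + 1)) = Real.log 2 := by rw [hε]; field_simp
      nlinarith [haL (k + 1)]
  have hsum (n : ℕ) : (1 + ε) * (2 * ∑ k ∈ Finset.range (n + 1),
      Real.posLog (cuspWinding G γ x k)) ≤ σ n + (1 + ε) * (2 * L) := by
    induction n with
    | zero =>
      rw [zero_add, Finset.sum_range_one]
      nlinarith [hσ0 0, haL 0]
    | succ n ih =>
      rw [Finset.sum_range_succ]
      linarith [hstep n]
  -- The differences of σ miss the initial and the last block; each contributes at most (1 + ε) · 2
  -- L.
  refine ⟨ε, hε0, 2 * ((1 + ε) * (2 * L)), fun n => ?_⟩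
  have hent (n : ℕ) : 0 ≤ entryTime G x n := (hT.tile_mem_and hx n).2.1
  have hc : 0 ≤ (1 + ε) * (2 * L) := by positivity
  match n with
  | 0 =>
    rw [Finset.sum_range_zero]
    linarith [hent (blockStart (symmSet γ) (letter G x) 0)]
  | 1 =>
    rw [Finset.sum_range_one]
    nlinarith [hent (blockStart (symmSet γ) (letter G x) 1), haL 0]
  | n + 2 =>
    rw [Finset.sum_range_succ]
    nlinarith [hsum n, hσ n, haL (n + 1)]

/-- At the radial return times the orbit of the block products keeps up with the ray. -/
theorem IsFreeFuchsian.exists_le_dist_blockProd (hG : IsFreeFuchsian G h γ)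
    (hx : x ∈ radialLimitSet G) {N : ℕ} (hN : ∀ n, cuspWinding G γ x n ≤ N) :
    ∃ C, ∀ M : ℕ, ∀ T : ℝ, ∃ t, T ≤ t ∧ ∃ n, M ≤ n ∧
      entryTime G x (blockStart (symmSet γ) (letter G x) n) ≤ t ∧
      t ≤ dist (blockProd G γ x n • I) I + C := by
  have hT := hG.hasTreeSides
  have hrun := hG.exists_letter_ne hx
  have hbm := blockStart_strictMono hrun
  obtain ⟨D, hD⟩ : ∃ D, ∀ s ∈ sideLabels G, dist (s • I) I ≤ D := by
    have hfin : (sideLabels G).Finite := by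
      rw [hG.sides]
      exact (finite_symmSet h).union (finite_symmSet γ)
    obtain ⟨D, hD⟩ := (hfin.image fun s => dist (s • I) I).bddAbove
    exact ⟨D, fun s hs => hD ⟨s, hs, rfl⟩⟩
  have hD' (j : ℕ) := hD _ (hT.letter_mem hx j)
  have hD0 : 0 ≤ D := dist_nonneg.trans (hD' 0)
  obtain ⟨c, hc⟩ := id hx
  refine ⟨c + N * D, fun M T => ?_⟩
  obtain ⟨t, ⟨k, hk, hkc⟩, htT, ht0, htM⟩ := (hc.and_eventually ((eventually_ge_atTop T).and
    ((eventually_ge_atTop 0).and (eventually_ge_atTop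
      (entryTime G x (blockStart (symmSet γ) (letter G x) M)))))).exists
  obtain ⟨j, hj1, hj2⟩ := hT.exists_between_entryTime hx ht0
  obtain ⟨n, hn1, hn2⟩ := exists_blockStart_le hrun j
  refine ⟨t, htT, n, ?_, (hT.entryTime_monotone hx hn1).trans hj1, ?_⟩
  · have h1 : blockStart (symmSet γ) (letter G x) M < j + 1 :=
      (hT.entryTime_monotone hx).reflect_lt (htM.trans_lt hj2)
    have h2 := hbm.lt_iff_lt.1 (lt_of_le_of_lt (Nat.lt_succ_iff.1 h1) hn2)
    omega
  · obtain ⟨i, rfl⟩ := Nat.exists_eq_add_of_le hn1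
    -- Blocks have length at most N + 1, so the tile reached is at most N letters past the start of
    -- its block.
    have hi : i ≤ N := by
      have : cuspWinding G γ x n = blockStart (symmSet γ) (letter G x) (n + 1) -
        blockStart (symmSet γ) (letter G x) n - 1 := rfl
      have := hN n
      omega
    have h1 := dist_tile_add_le hD' (blockStart (symmSet γ) (letter G x) n) i
    have h2 : (i : ℝ) * D ≤ N * D := by gcongr
    have h3 := (mem_smul_dirichletDomain_iff (hT.tile_mem hx _) _).1
      (hT.ray_mem_tile hx hj1 hj2.le) k hk
    have h4 := dist_triangle4 (ray x t)
      (tile G x (blockStart (symmSet γ) (letter G x) n + i) • I) (blockProd G γ x n • I) I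
    rw [dist_ray_I, abs_of_nonneg ht0] at h4
    have h5 : blockProd G γ x n = tile G x (blockStart (symmSet γ) (letter G x) n) := rfl
    rw [h5] at h4 ⊢
    linarith

end CuspWinding

theorem fact3 {u v : ℕ} (hv : 1 ≤ v) (huv : 1 < u + v) (G : Subgroup SL(2, ℝ))
    (h : Fin u → SL(2, ℝ)) (γ : Fin v → SL(2, ℝ))
    (hG : CuspWinding.IsFreeFuchsian G h γ)
    (x : OnePoint ℝ) (hx : x ∈ CuspWinding.levelSet G γ 1) :
    ¬ BddAbove (Set.range fun n : ℕ => CuspWinding.cuspWinding G γ x n) := by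
  rintro ⟨N, hN⟩
  obtain ⟨hxr, hlim⟩ := hx
  have hN' (n : ℕ) : CuspWinding.cuspWinding G γ x n ≤ N := hN ⟨n, rfl⟩
  obtain ⟨ε, hε, C, hC⟩ := hG.exists_sum_posLog_le hxr hN'
  obtain ⟨C', hC'⟩ := hG.exists_le_dist_blockProd hxr hN'
  have hlt : 1 / (1 + ε / 2) < 1 := by
    rw [div_lt_one (by positivity)]
    linarith
  obtain ⟨M, hM⟩ := eventually_atTop.1 (hlim.eventually_const_lt hlt)
  obtain ⟨t, ht, n, hn, hle, hd⟩ :=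
    -- Beyond this time the bounds d < (1 + ε/2) S, (1 + ε) S ≤ t + C and t ≤ d + C' are
    -- incompatible.
    hC' M (((1 + ε) * C' + (1 + ε / 2) * C) / (ε / 2) + 1)
  have hratio := hM n hn
  have hS := hC n
  set S := 2 * ∑ k ∈ Finset.range n, Real.posLog (CuspWinding.cuspWinding G γ x k)
  set d := dist (CuspWinding.blockProd G γ x n • I) I
  -- If d = 0 the quotient would be 0 by the convention for division by zero, below the positive
  -- threshold.
  have hd0 : 0 < d := by
    refine lt_of_le_of_ne dist_nonneg fun h0 => ?_
    rw [← h0, div_zero] at hratio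
    exact absurd hratio (not_lt.2 (by positivity))
  rw [div_lt_div_iff₀ (by positivity) hd0, one_mul] at hratio
  have h1 : ((1 + ε) * C' + (1 + ε / 2) * C) / (ε / 2) < t := by linarith
  rw [div_lt_iff₀ (by positivity)] at h1
  nlinarith
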